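/- Let $(\mathbf{x}_i,y_i)_{i=1}^m\subseteq\mathbb{R}^d\times\{\pm1\}$ be a dataset and let $f(\mathbf{x};\theta)$, $\theta\in\mathbb{R}^p$, be a model such that, for some $L\ge 1$ and every $\mathbf{x}\in\mathbb{R}^d$, the function $f(\mathbf{x};\cdot)$ is $C^1$ on $\mathbb{R}^p$ and $f(\mathbf{x};\alpha\theta)=\alpha^L f(\mathbf{x};\theta)$ for all $\alpha>0$, $\theta\in\mathbb{R}^p$. Let $\mathcal{L}(\theta)=\sum_{i=1}^m e^{-\varphi(y_if(\mathbf{x}_i;\theta))}$, where $\varphi\in C^2(\mathbb{R})$ satisfies $0<\varphi'\le B_1$ and $0\le\varphi''\le B_2$ on $\mathbb{R}$ for some constants $B_1,B_2$ (this includes the exponential and the logistic loss). For a locally Lipschitz $F:\mathbb{R}^p\to\mathbb{R}$, let $\partial F(\theta)$ be the Clarke subdifferential, i.e. the convex hull of all limits $\lim_k\nabla F(\theta_k)$ with $\theta_k\to\theta$ and $F$ differentiable at each $\theta_k$ (so $\partial F(\theta)=\{\nabla F(\theta)\}$ if $F$ is $C^1$). Let $\|\cdot\|$ be any norm on $\mathbb{R}^p$,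 with dual norm $\|\mathbf{v}\|_\star=\max_{\|\mathbf{u}\|=1}\langle \mathbf{u},\mathbf{v}\rangle$. Let $c>0$, and let $\eta:[0,\infty)\to(0,\infty)$ be integrable on bounded intervals with $$\int_0^\infty\eta(t)\,dt=\infty\quad\text{and}\quad \eta(t)=o\bigl(t^{\frac1L-1}\bigr)\ \ (t\to\infty).$$ Let $\theta_t$, $t\ge0$, be a curve in $\mathbb{R}^p$, absolutely continuous on compact intervals, that is a trajectory of normalized or of unnormalized momentum steepest descent on $\mathcal{L}$ with respect to $\|\cdot\|$: with $\mathbf{g}_t\in\partial\mathcal{L}(\theta_t)$ and $\mathbf{m}_t=\int_0^t c\,e^{-c(t-s)}\mathbf{g}_s\,ds$, either for almost every $t\ge0$ $$\frac{d\theta_t}{dt}\in\eta(t)\cdot\operatorname*{arg\,min}_{\|\mathbf{u}\|=1}\langle\mathbf{u},\mathbf{m}_t\rangle ,$$ or for almost every $t\ge0$ $$\frac{d\theta_t}{dt}\in\eta(t)\cdot\operatorname*{arg\,min}_{\|\mathbf{u}\|=\|\mathbf{m}_t\|_\star}\langle\mathbf{u},\mathbf{m}_t\rangle .$$ Assume that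 there are $N_{\min}>0$ and $t_0\ge0$ with $\|\theta_t\|\ge N_{\min}$ for all $t\ge t_0$, and that $\theta_t/\|\theta_t\|$ converges, as $t\to\infty$, to some $\bar\theta$ with positive margin $\gamma(\bar\theta)=\min_{i}y_if(\mathbf{x}_i;\bar\theta/\|\bar\theta\|)>0$. Then $\bar\theta$ is the direction of a KKT point of the $\|\cdot\|$-max-margin problem $$\min_{\theta\in\mathbb{R}^p}\tfrac12\|\theta\|^2\quad\text{subject to}\quad y_if(\mathbf{x}_i;\theta)\ge1\ \text{ for all } i .$$ That is, there is $s>0$ such that $\hat\theta=s\bar\theta$ satisfies $y_if(\mathbf{x}_i;\hat\theta)\ge1$ for all $i$, and there are $\mathbf{k}\in\partial\tfrac12\|\hat\theta\|^2$, $\lambda_1,\dots,\lambda_m\ge0$ and $\mathbf{h}_i\in\partial f(\mathbf{x}_i;\hat\theta)$ with $$\sum_{i=1}^m\lambda_iy_i\mathbf{h}_i-\mathbf{k}=0\quad\text{and}\quad\sum_{i=1}^m\lambda_i\bigl(y_if(\mathbf{x}_i;\hat\theta)-1\bigr)=0 .$$ -/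

import Mathlib

noncomputable section

namespace MomentumSD

open Filter Topology MeasureTheory

/-- `ℝⁿ` with its standard inner product. The norm used by the optimizer is a separate object `N`. -/
abbrev Vec (n : ℕ) : Type := EuclideanSpace ℝ (Fin n)

/-- A norm on `ℝᵖ`: a seminorm that vanishes only at the origin. -/
def IsNorm {p : ℕ} (N : Seminorm ℝ (Vec p)) : Prop :=
  ∀ u : Vec p, N u = 0 → u = 0

/-- The dual norm `max_{N u = 1} ⟪u, v⟫`. -/
def dualNorm {p : ℕ} (N : Seminorm ℝ (Vec p)) (v : Vec p) : ℝ :=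
  sSup {r : ℝ | ∃ u : Vec p, N u = 1 ∧ r = inner ℝ u v}

/-- The set of minimizers `argmin_{N u = r} ⟪u, v⟫`. -/
def argminOnSphere {p : ℕ} (N : Seminorm ℝ (Vec p)) (r : ℝ) (v : Vec p) : Set (Vec p) :=
  {u | N u = r ∧ ∀ w : Vec p, N w = r → inner ℝ u v ≤ inner ℝ w v}

/-- The Clarke subdifferential: the convex hull of the limits of gradients at points of
differentiability that converge to `θ`. -/
def clarkeSubdifferential {p : ℕ} (F : Vec p → ℝ) (θ : Vec p) : Set (Vec p) :=
  convexHull ℝ {v | ∃ u : ℕ → Vec p, (∀ k, DifferentiableAt ℝ F (u k)) ∧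
    Tendsto u atTop (𝓝 θ) ∧ Tendsto (fun k => gradient F (u k)) atTop (𝓝 v)}

/-- Admissible loss exponents: `φ ∈ C²(ℝ)` with `0 < φ' ≤ B₁` and `0 ≤ φ'' ≤ B₂`. -/
structure IsLossExponent (φ : ℝ → ℝ) : Prop where
  contDiff : ContDiff ℝ 2 φ
  deriv_bounds : ∃ B₁ : ℝ, ∀ u, 0 < deriv φ u ∧ deriv φ u ≤ B₁
  deriv2_bounds : ∃ B₂ : ℝ, ∀ u, 0 ≤ deriv (deriv φ) u ∧ deriv (deriv φ) u ≤ B₂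

/-- The training loss `∑ᵢ exp (-φ (yᵢ f (xᵢ; θ)))`. -/
def loss {d p m : ℕ} (φ : ℝ → ℝ) (f : Vec d → Vec p → ℝ) (x : Fin m → Vec d) (y : Fin m → ℝ)
    (θ : Vec p) : ℝ :=
  ∑ i, Real.exp (-φ (y i * f (x i) θ))

/-- The hard margin `minᵢ yᵢ f (xᵢ; θ / N θ)`. (It takes the value `0` for an empty dataset, so a
positive margin forces the dataset to be nonempty.) -/
def margin {d p m : ℕ} (N : Seminorm ℝ (Vec p)) (f : Vec d → Vec p → ℝ) (x : Fin m → Vec d)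
    (y : Fin m → ℝ) (θ : Vec p) : ℝ :=
  ⨅ i, y i * f (x i) ((N θ)⁻¹ • θ)

/-- An arc on `[0, ∞)`: absolutely continuous on every compact interval. -/
def IsArc {p : ℕ} (θ : ℝ → Vec p) : Prop :=
  ∃ v : ℝ → Vec p, (∀ t, 0 ≤ t → IntervalIntegrable v volume 0 t) ∧
    ∀ t, 0 ≤ t → θ t = θ 0 + ∫ s in (0 : ℝ)..t, v s

/-- The momentum estimate `m_t = ∫₀ᵗ c e^{-c (t - s)} g_s ds`, the solution of `m' = c (g - m)`,
`m_0 = 0`. -/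
def momentum {p : ℕ} (c : ℝ) (g : ℝ → Vec p) (t : ℝ) : Vec p :=
  ∫ s in (0 : ℝ)..t, (c * Real.exp (-c * (t - s))) • g s

/-- Normalized momentum steepest descent on the objective `F` (learning rate `η`, momentum
parameter `c`): for a choice of subgradients `g_t ∈ ∂F(θ_t)` with momentum estimate `m_t`, for almost
every `t` one has `dθ/dt ∈ η(t) · argmin_{N u = 1} ⟪u, m_t⟫`. -/
def IsNormalizedMSD {p : ℕ} (N : Seminorm ℝ (Vec p)) (F : Vec p → ℝ) (c : ℝ) (η : ℝ → ℝ)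
    (θ : ℝ → Vec p) : Prop :=
  IsArc θ ∧ ∃ g : ℝ → Vec p, (∀ t, 0 ≤ t → g t ∈ clarkeSubdifferential F (θ t)) ∧
    ∀ᵐ t : ℝ, 0 < t → ∃ u ∈ argminOnSphere N 1 (momentum c g t), HasDerivAt θ (η t • u) t

/-- (Unnormalized) momentum steepest descent:
`dθ/dt ∈ η(t) · argmin_{N u = N_*(m_t)} ⟪u, m_t⟫` for almost every `t`. -/
def IsUnnormalizedMSD {p : ℕ} (N : Seminorm ℝ (Vec p)) (F : Vec p → ℝ) (c : ℝ) (η : ℝ → ℝ)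
    (θ : ℝ → Vec p) : Prop :=
  IsArc θ ∧ ∃ g : ℝ → Vec p, (∀ t, 0 ≤ t → g t ∈ clarkeSubdifferential F (θ t)) ∧
    ∀ᵐ t : ℝ, 0 < t → ∃ u ∈ argminOnSphere N (dualNorm N (momentum c g t)) (momentum c g t),
      HasDerivAt θ (η t • u) t

/-- `θ` is a KKT point of `min ½ (N θ)²` subject to `yᵢ f (xᵢ; θ) ≥ 1` for all `i`. -/
def IsKKTPoint {d p m : ℕ} (N : Seminorm ℝ (Vec p)) (f : Vec d → Vec p → ℝ) (x : Fin m → Vec d)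
    (y : Fin m → ℝ) (θ : Vec p) : Prop :=
  (∀ i, 1 ≤ y i * f (x i) θ) ∧
  ∃ (k : Vec p) (lam : Fin m → ℝ) (h : Fin m → Vec p),
    k ∈ clarkeSubdifferential (fun u => (1 / 2 : ℝ) * N u ^ 2) θ ∧
    (∀ i, 0 ≤ lam i) ∧
    (∀ i, h i ∈ clarkeSubdifferential (f (x i)) θ) ∧
    (∑ i, (lam i * y i) • h i) - k = 0 ∧
    ∑ i, lam i * (y i * f (x i) θ - 1) = 0

end MomentumSD

end

namespace MomentumSD

open Filter Topology MeasureTheory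

/-! ### Absolutely continuous functions -/

/-! Write `F i = y i * f (x i)`, `g` for the gradient of the loss `ℓ` along the curve, `D` for its
dual norm and `N` for `N (θ t)`.

Momentum is asymptotically harmless. By homogeneity `-g` is a positive combination of the convergent
vectors `gradient (F i) (θ / N)`, with coefficients `w i`. Euler's identity and the positive limit
margin exclude cancellation: `∑ w i ≤ 2 / (L γ) * D` (`eventually_sum_lossWeight_le`). The decay `η
= o(t^(1/L - 1))` gives `‖θ t‖ = O(t^(1/L))`, and it is exactly the rate that makes every `log (w
i)` eventually `ε`-Lipschitz in time (`eventually_abs_log_weight_sub_le`). An exponential average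
with fixed rate `c` of so slow a quantity has vanishing relative error (`momentum_sub_le`), so the
curve performs steepest descent on the true gradient up to a factor `1 - δ`
(`eventually_inner_gradient_le`).

Descent with `∫ η = ∞` forces `ℓ → 0` (`tendsto_loss`), hence `N → ∞`. Put `Z = -log ℓ - φ 0`.
Convexity of `φ` gives `L ℓ Z ≤ -⟪g, θ⟫`. If `-⟪g, θ⟫ ≤ (1 - ε) N D` held from some time on, `log Z`
would grow at least `(1 + ε/2) L` times as fast as `log N`, against the bound `Z ≤ M N^L`. So `-g /
D` comes arbitrarily close to norming `θ / N` at arbitrarily late times (`frequently_inner_gt`).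

Along such times `-g / D` subconverges to `v = ∑ lam i • gradient (F i) θbar`, where `v` has dual
norm at most `1` and `⟪θbar, v⟫ = 1`; weights of margins that are not minimal vanish in the limit,
which is complementary slackness (`exists_multipliers`). Such a `v` yields a subgradient of `½ N²`,
and rescaling `θbar` to margin `1` gives the KKT conditions (`isKKTPoint_of_multipliers`). -/

/-- Transfers absolute continuity from `∫ η` to the curve, and from there to its norm, its loss and
their logarithms. -/
theorem absolutelyContinuousOnInterval_of_dist_le {X Y : Type*} [PseudoMetricSpace X]
    [PseudoMetricSpace Y] {h : ℝ → X} {A : ℝ → Y} {a b C : ℝ}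
    (hA : AbsolutelyContinuousOnInterval A a b)
    (hle : ∀ s ∈ Set.uIcc a b, ∀ t ∈ Set.uIcc a b, dist (h s) (h t) ≤ C * dist (A s) (A t)) :
    AbsolutelyContinuousOnInterval h a b := by
  unfold AbsolutelyContinuousOnInterval at *
  refine squeeze_zero' (Eventually.of_forall fun E => Finset.sum_nonneg fun _ _ => dist_nonneg) ?_
    (by simpa using hA.const_mul C)
  filter_upwards [mem_inf_of_right (mem_principal_self _)] with E hE
  rw [Finset.mul_sum]
  exact Finset.sum_le_sum fun i hi => hle _ (hE.1 i hi).1 _ (hE.1 i hi).2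

theorem le_of_ae_deriv_nonneg {h : ℝ → ℝ} {a b : ℝ} (hab : a ≤ b)
    (hac : AbsolutelyContinuousOnInterval h a b)
    (hd : ∀ᵐ t : ℝ, t ∈ Set.Icc a b → DifferentiableAt ℝ h t → 0 ≤ deriv h t) : h a ≤ h b := by
  rw [← sub_nonneg, ← hac.integral_deriv_eq_sub]
  apply intervalIntegral.integral_nonneg_of_ae_restrict hab
  rw [EventuallyLE, ae_restrict_iff' measurableSet_Icc]
  filter_upwards [hd, hac.ae_differentiableAt] with t h1 h2 ht
  rw [Set.uIcc_of_le hab] at h2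
  exact h1 ht (h2 ht)

/-! ### Convex hulls of compact sets -/

/-- Carathéodory: `finrank + 1` points suffice, so the hull is the continuous image of a simplex
times a power of `G`. Shorter combinations are padded with weight `0` at `z₀`. -/
theorem isCompact_convexHull_of_isCompact {E : Type*} [NormedAddCommGroup E] [NormedSpace ℝ E]
    [FiniteDimensional ℝ E] {G : Set E} (hG : IsCompact G) : IsCompact (convexHull ℝ G) := by
  rcases G.eq_empty_or_nonempty with rfl | ⟨z₀, hz₀⟩
  · simp
  set n := Module.finrank ℝ E + 1
  have hK : IsCompact ((stdSimplex ℝ (Fin n)) ×ˢ (Set.univ.pi fun _ : Fin n => G)) :=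
    (isCompact_stdSimplex ℝ _).prod (isCompact_univ_pi fun _ => hG)
  have hcont : Continuous fun q : (Fin n → ℝ) × (Fin n → E) => ∑ i, q.1 i • q.2 i := by fun_prop
  convert! hK.image hcont using 1
  ext x
  constructor
  · intro hx
    obtain ⟨ι, _, z, w, hz, haff, hw, hw1, rfl⟩ := eq_pos_convex_span_of_mem_convexHull hx
    have hcard : Fintype.card ι ≤ Fintype.card (Fin n) := by
      simpa [n] using haff.card_le_finrank_succ.trans
        (Nat.succ_le_succ (Submodule.finrank_le _))
    obtain ⟨e⟩ := Function.Embedding.nonempty_of_card_le hcard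
    refine ⟨(Function.extend e w 0, Function.extend e z fun _ => z₀), ⟨⟨?_, ?_⟩, ?_⟩, ?_⟩
    · intro j
      by_cases hj : ∃ i, e i = j
      · obtain ⟨i, rfl⟩ := hj
        simpa [e.injective.extend_apply] using (hw i).le
      · simp [Function.extend_apply' _ _ _ hj]
    · rw [← hw1]
      symm
      refine Fintype.sum_of_injective e e.injective _ _ ?_ ?_
      · intro j hj
        simp [Function.extend_apply' _ _ _ (by simpa using hj)]
      · intro i
        simp [e.injective.extend_apply]
    · intro j _
      by_cases hj : ∃ i, e i = j
      · obtain ⟨i, rfl⟩ := hj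
        simpa [e.injective.extend_apply] using hz ⟨i, rfl⟩
      · simpa [Function.extend_apply' _ _ _ hj] using hz₀
    · symm
      refine Fintype.sum_of_injective e e.injective _ _ ?_ ?_
      · intro j hj
        simp [Function.extend_apply' _ _ _ (show ¬ ∃ i, e i = j by simpa using hj)]
      · intro i
        simp [e.injective.extend_apply]
  · rintro ⟨⟨w, z⟩, ⟨⟨hw, hw1⟩, hz⟩, rfl⟩
    exact (convex_convexHull ℝ G).sum_mem (fun i _ => hw i) hw1
      fun i _ => subset_convexHull ℝ G (hz i trivial)

/-! ### Momentum estimates of slowly varying gradients -/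

/-- The integrand has an explicit primitive. Its value at `s = t` is the right-hand side; its value
at `s = T` is nonnegative and is dropped. -/
theorem integral_exp_weight_le {c ε K M T t : ℝ} (hε : 0 < ε) (hεc : ε < c) (hK : 0 ≤ K)
    (hM : 0 ≤ M) (hTt : T ≤ t) :
    ∫ s in T..t, (c * Real.exp (-c * (t - s))) * (K * (Real.exp (ε * (t - s)) - 1 + ε) * M) ≤
      K * (c / (c - ε) - 1 + ε) * M := by
  have hcε : 0 < c - ε := sub_pos.2 hεc
  have hder : ∀ s, HasDerivAt (fun s => (K * M) * (c / (c - ε) * Real.exp (-(c - ε) * (t - s)) +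
      (ε - 1) * Real.exp (-c * (t - s))))
      ((c * Real.exp (-c * (t - s))) * (K * (Real.exp (ε * (t - s)) - 1 + ε) * M)) s := by
    intro s
    have h1 : HasDerivAt (fun s => -(c - ε) * (t - s)) (c - ε) s := by
      simpa using ((hasDerivAt_id s).const_sub t).const_mul (-(c - ε))
    have h2 : HasDerivAt (fun s => -c * (t - s)) c s := by
      simpa using ((hasDerivAt_id s).const_sub t).const_mul (-c)
    have h3 := (((h1.exp.const_mul (c / (c - ε))).add (h2.exp.const_mul (ε - 1))).const_mul (K * M))
    convert! h3 using 1
    have : Real.exp (-(c - ε) * (t - s)) = Real.exp (-c * (t - s)) * Real.exp (ε * (t - s)) := by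
      rw [← Real.exp_add]; ring_nf
    rw [this]
    field_simp
    ring
  rw [intervalIntegral.integral_eq_sub_of_hasDerivAt (fun s _ => hder s)
    (by apply Continuous.intervalIntegrable; fun_prop)]
  have hx : Real.exp (-c * (t - T)) ≤ Real.exp (-(c - ε) * (t - T)) := by
    apply Real.exp_le_exp.2
    nlinarith
  have hq : 1 ≤ c / (c - ε) := by rw [le_div_iff₀ hcε]; linarith
  have hy : 0 < Real.exp (-c * (t - T)) := Real.exp_pos _
  have hKM : 0 ≤ K * M := mul_nonneg hK hM
  simp only [sub_self, mul_zero, Real.exp_zero]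
  have : 0 ≤ c / (c - ε) * Real.exp (-(c - ε) * (t - T)) + (ε - 1) * Real.exp (-c * (t - T)) := by
    nlinarith
  nlinarith

/-- The average forgets at rate `c`, while `g` seen backwards from `t` grows at most like `e^(ε (t -
s))` with `ε < c`. The error splits at a fixed `T` into the memory of `[0, T]`, the variation of `g`
on `[T, t]`, and the missing mass `e^(-c (t - T))` of the kernel. -/
theorem momentum_sub_le {p : ℕ} {c : ℝ} (hc : 0 < c) {g : ℝ → Vec p}
    (hg : ContinuousOn g (Set.Ici 0)) (hg0 : ∀ᶠ t in atTop, g t ≠ 0) {K : ℝ} (hK : 0 ≤ K)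
    (hslow : ∀ ε : ℝ, 0 < ε → ∀ᶠ T in atTop, ∀ s t : ℝ, T ≤ s → s ≤ t →
      ‖g s - g t‖ ≤ K * (Real.exp (ε * (t - s)) - 1 + ε) * ‖g t‖) (δ : ℝ) (hδ : 0 < δ) :
    ∀ᶠ t in atTop, ‖momentum c g t - g t‖ ≤ δ * ‖g t‖ := by
  obtain ⟨ε, hε, hεc, hεδ⟩ : ∃ ε : ℝ, 0 < ε ∧ ε < c ∧ K * (c / (c - ε) - 1 + ε) < δ / 2 := by
    have ht : Tendsto (fun ε : ℝ => K * (c / (c - ε) - 1 + ε)) (𝓝[>] 0) (𝓝 0) := by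
      have : ContinuousAt (fun ε : ℝ => K * (c / (c - ε) - 1 + ε)) 0 := by
        have : c - 0 ≠ 0 := by simpa using hc.ne'
        fun_prop (disch := assumption)
      have h2 := this.tendsto
      simp only [sub_zero, div_self hc.ne', sub_self, add_zero, mul_zero] at h2
      exact h2.mono_left nhdsWithin_le_nhds
    have h1 := ht.eventually (gt_mem_nhds (half_pos hδ))
    have h2 : ∀ᶠ ε : ℝ in 𝓝[>] 0, ε < c := nhdsWithin_le_nhds (gt_mem_nhds hc)
    obtain ⟨ε, h1, h2, h3⟩ := (h1.and (h2.and self_mem_nhdsWithin)).exists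
    exact ⟨ε, h3, h2, h1⟩
  obtain ⟨T, hT, hgT, hT0⟩ := ((hslow ε hε).and (hg0.and (eventually_ge_atTop (0 : ℝ)))).exists
  set M : ℝ := ‖∫ s in (0 : ℝ)..T, (c * Real.exp (c * s)) • g s‖ with hM
  have hgTpos : 0 < ‖g T‖ := norm_pos_iff.2 hgT
  set Q : ℝ := M * (1 + K + K * ε) / ‖g T‖
  have hlim : Tendsto (fun t : ℝ => Real.exp (-c * t) * (Real.exp (ε * (t - T)) * Q) +
      Real.exp (-c * (t - T))) atTop (𝓝 0) := by
    have e1 : Tendsto (fun t : ℝ => Real.exp (-(c - ε) * t)) atTop (𝓝 0) :=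
      Real.tendsto_exp_atBot.comp (tendsto_id.const_mul_atTop_of_neg (by linarith))
    have e2 : Tendsto (fun t : ℝ => Real.exp (-c * t)) atTop (𝓝 0) :=
      Real.tendsto_exp_atBot.comp (tendsto_id.const_mul_atTop_of_neg (by linarith))
    have e3 := (e1.mul_const (Real.exp (-ε * T) * Q)).add (e2.mul_const (Real.exp (c * T)))
    simp only [zero_mul, add_zero] at e3
    refine e3.congr fun t => ?_
    rw [← mul_assoc, ← mul_assoc, ← Real.exp_add, ← Real.exp_add, ← Real.exp_add]
    ring_nf
  filter_upwards [eventually_ge_atTop T, hlim.eventually (gt_mem_nhds (half_pos hδ))] with t hTt ht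
  have ht0 : 0 ≤ t := hT0.trans hTt
  have hint : ∀ a b : ℝ, 0 ≤ a → 0 ≤ b →
      IntervalIntegrable (fun s => (c * Real.exp (-c * (t - s))) • g s) volume a b := by
    intro a b ha hb
    apply ContinuousOn.intervalIntegrable
    have : ContinuousOn g (Set.uIcc a b) := hg.mono fun z hz => (le_min ha hb).trans hz.1
    fun_prop
  have hk : ∫ s in T..t, c * Real.exp (-c * (t - s)) = 1 - Real.exp (-c * (t - T)) := by
    rw [intervalIntegral.integral_eq_sub_of_hasDerivAt
      (f := fun s => Real.exp (-c * (t - s))) (fun s _ => ?_)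
      (by apply Continuous.intervalIntegrable; fun_prop)]
    · simp
    · have h2 : HasDerivAt (fun s => -c * (t - s)) c s := by
        simpa using ((hasDerivAt_id s).const_sub t).const_mul (-c)
      simpa [mul_comm] using h2.exp
  have hsplit : momentum c g t - g t = Real.exp (-c * t) • (∫ s in (0 : ℝ)..T,
      (c * Real.exp (c * s)) • g s) + (∫ s in T..t, (c * Real.exp (-c * (t - s))) • (g s - g t)) -
      Real.exp (-c * (t - T)) • g t := by
    have h1 : ∫ s in T..t, (c * Real.exp (-c * (t - s))) • (g s - g t) =
        (∫ s in T..t, (c * Real.exp (-c * (t - s))) • g s) -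
          (1 - Real.exp (-c * (t - T))) • g t := by
      simp only [smul_sub]
      rw [intervalIntegral.integral_sub (hint _ _ hT0 ht0)
        (by apply Continuous.intervalIntegrable; fun_prop),
        intervalIntegral.integral_smul_const, hk]
    have h2 : Real.exp (-c * t) • (∫ s in (0 : ℝ)..T, (c * Real.exp (c * s)) • g s) =
        ∫ s in (0 : ℝ)..T, (c * Real.exp (-c * (t - s))) • g s := by
      rw [← intervalIntegral.integral_smul]
      congr 1
      ext1 s
      rw [smul_smul, mul_left_comm, ← Real.exp_add]
      ring_nf
    rw [h1, h2, momentum, ← intervalIntegral.integral_add_adjacent_intervals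
      (hint 0 T le_rfl hT0) (hint T t hT0 ht0)]
    module
  have hmid : ‖∫ s in T..t, (c * Real.exp (-c * (t - s))) • (g s - g t)‖ ≤
      K * (c / (c - ε) - 1 + ε) * ‖g t‖ := by
    refine le_trans ?_ (integral_exp_weight_le hε hεc hK (norm_nonneg (g t)) hTt)
    refine intervalIntegral.norm_integral_le_of_norm_le hTt ?_
      (by apply Continuous.intervalIntegrable; fun_prop)
    refine Eventually.of_forall fun s hs => ?_
    rw [norm_smul, Real.norm_of_nonneg (by positivity)]
    gcongr
    exact hT s t hs.1.le hs.2
  -- Slow variation read in the other direction: `g` decays no faster than `e^(-ε (t - T))`, so the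
  -- old memory, of size `e^(-c t)`, is negligible against `‖g t‖`.
  have hlow : ‖g T‖ ≤ (1 + K + K * ε) * Real.exp (ε * (t - T)) * ‖g t‖ := by
    have h1 : ‖g T‖ ≤ ‖g T - g t‖ + ‖g t‖ := by simpa using norm_add_le (g T - g t) (g t)
    have h2 := hT T t le_rfl hTt
    have h3 : 1 ≤ Real.exp (ε * (t - T)) := Real.one_le_exp (by nlinarith)
    have h4 : 0 ≤ ‖g t‖ := norm_nonneg _
    have h5 : K * (Real.exp (ε * (t - T)) - 1 + ε) + 1 ≤
        (1 + K + K * ε) * Real.exp (ε * (t - T)) := by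
      have : 0 ≤ K * ε := by positivity
      nlinarith
    nlinarith
  have hfirst : Real.exp (-c * t) * M ≤
      Real.exp (-c * t) * (Real.exp (ε * (t - T)) * Q) * ‖g t‖ := by
    rw [mul_assoc]
    gcongr
    have : Real.exp (ε * (t - T)) * Q * ‖g t‖ =
        M * (((1 + K + K * ε) * Real.exp (ε * (t - T)) * ‖g t‖) / ‖g T‖) := by
      simp only [Q]; ring
    rw [this]
    apply le_mul_of_one_le_right (norm_nonneg _)
    rwa [one_le_div hgTpos]
  calc ‖momentum c g t - g t‖ ≤ Real.exp (-c * t) * M + K * (c / (c - ε) - 1 + ε) * ‖g t‖ +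
        Real.exp (-c * (t - T)) * ‖g t‖ := by
        rw [hsplit]
        refine (norm_sub_le _ _).trans (add_le_add ((norm_add_le _ _).trans (add_le_add ?_ hmid)) ?_)
        · rw [norm_smul, Real.norm_of_nonneg (Real.exp_pos _).le]
        · rw [norm_smul, Real.norm_of_nonneg (Real.exp_pos _).le]
    _ ≤ δ * ‖g t‖ := by nlinarith [norm_nonneg (g t)]

theorem norm_momentum_le {p : ℕ} {c : ℝ} (hc : 0 < c) {g : ℝ → Vec p} {G : ℝ}
    (hG : ∀ t, 0 ≤ t → ‖g t‖ ≤ G) {t : ℝ} (ht : 0 ≤ t) : ‖momentum c g t‖ ≤ G := by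
  have hG0 : 0 ≤ G := (norm_nonneg _).trans (hG 0 le_rfl)
  have hk : ∫ s in (0 : ℝ)..t, c * Real.exp (-c * (t - s)) * G =
      G - Real.exp (-c * t) * G := by
    rw [intervalIntegral.integral_eq_sub_of_hasDerivAt
      (f := fun s => Real.exp (-c * (t - s)) * G) (fun s _ => ?_)
      (by apply Continuous.intervalIntegrable; fun_prop)]
    · simp
    · have h2 : HasDerivAt (fun s => -c * (t - s)) c s := by
        simpa using ((hasDerivAt_id s).const_sub t).const_mul (-c)
      simpa [mul_comm] using h2.exp.mul_const G
  have : ‖momentum c g t‖ ≤ ∫ s in (0 : ℝ)..t, c * Real.exp (-c * (t - s)) * G := by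
    refine intervalIntegral.norm_integral_le_of_norm_le ht ?_
      (by apply Continuous.intervalIntegrable; fun_prop)
    refine Eventually.of_forall fun s hs => ?_
    rw [norm_smul, Real.norm_of_nonneg (by positivity)]
    gcongr
    exact hG s hs.1.le
  rw [hk] at this
  have : 0 ≤ Real.exp (-c * t) * G := by positivity
  linarith

/-! ### Gradients and the Clarke subdifferential -/

theorem inner_gradient_sub_le_of_convexOn {p : ℕ} {F : Vec p → ℝ} (hF : ConvexOn ℝ Set.univ F)
    {u : Vec p} (hu : DifferentiableAt ℝ F u) (w : Vec p) :
    inner ℝ (gradient F u) (w - u) ≤ F w - F u := by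
  have hc := hF.comp_affineMap (AffineMap.lineMap u w : ℝ →ᵃ[ℝ] Vec p)
  have hd : HasDerivAt (F ∘ (AffineMap.lineMap u w : ℝ →ᵃ[ℝ] Vec p))
      (fderiv ℝ F u (w - u)) 0 := by
    refine HasFDerivAt.comp_hasDerivAt (0 : ℝ) (by simpa using hu.hasFDerivAt) ?_
    exact AffineMap.hasDerivAt_lineMap
  have := hc.le_slope_of_hasDerivAt (x := 0) (y := 1) trivial trivial one_pos hd
  simpa [slope, inner_gradient_left] using this

/-- If `k` were outside the compact convex hull, some direction `d` would strictly separate it.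
Differentiability points, dense by Rademacher's theorem, are chosen close to `θ + s n • d`;
monotonicity of subgradients then produces a limiting gradient `v` with `⟪v, d⟫ ≥ ⟪k, d⟫`,
contradicting the separation. -/
theorem subgradient_mem_clarkeSubdifferential {p : ℕ} {F : Vec p → ℝ}
    (hF : ConvexOn ℝ Set.univ F) {θ k : Vec p} (hk : ∀ w, inner ℝ k (w - θ) ≤ F w - F θ) :
    k ∈ clarkeSubdifferential F θ := by
  obtain ⟨K, S, hS, hK⟩ := hF.locallyLipschitzOn isOpen_univ (Set.mem_univ θ)
  rw [nhdsWithin_univ] at hS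
  obtain ⟨r, hr, hrS⟩ := Metric.mem_nhds_iff.1 hS
  have hKr : LipschitzOnWith K F (Metric.ball θ r) := hK.mono hrS
  have hbound : ∀ u ∈ Metric.ball θ r, ‖gradient F u‖ ≤ K := by
    intro u hu
    by_cases hd : DifferentiableAt ℝ F u
    · rw [gradient, LinearIsometryEquiv.norm_map]
      exact hd.hasFDerivAt.le_of_lipschitzOn (Metric.isOpen_ball.mem_nhds hu) hKr
    · simp [gradient_eq_zero_of_not_differentiableAt hd]
  have hdense : ∀ z ∈ Metric.ball θ r, ∀ ε > 0, ∃ u ∈ Metric.ball θ r, dist u z < ε ∧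
      DifferentiableAt ℝ F u := by
    intro z hz ε hε
    have hae := hKr.ae_differentiableWithinAt_of_mem (μ := volume)
    have hpos : 0 < volume (Metric.ball θ r ∩ Metric.ball z ε) :=
      (Metric.isOpen_ball.inter Metric.isOpen_ball).measure_pos volume
        ⟨z, hz, Metric.mem_ball_self hε⟩
    obtain ⟨u, hu, hd⟩ := (frequently_ae_mem_iff.2 hpos.ne').and_eventually hae |>.exists
    exact ⟨u, hu.1, hu.2, (hd hu.1).differentiableAt (Metric.isOpen_ball.mem_nhds hu.1)⟩
  set G : Set (Vec p) := {v | ∃ u : ℕ → Vec p, (∀ k, DifferentiableAt ℝ F (u k)) ∧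
    Tendsto u atTop (𝓝 θ) ∧ Tendsto (fun k => gradient F (u k)) atTop (𝓝 v)} with hG
  have hGclosed : IsClosed G := by
    -- `G` is a slice of the closure of the graph of the gradient, hence closed.
    have : G = (fun v => (θ, v)) ⁻¹'
        closure {q : Vec p × Vec p | DifferentiableAt ℝ F q.1 ∧ gradient F q.1 = q.2} := by
      ext v
      rw [Set.mem_preimage, mem_closure_iff_seq_limit]
      constructor
      · rintro ⟨u, hu, hu1, hu2⟩
        exact ⟨fun n => (u n, gradient F (u n)), fun n => ⟨hu n, rfl⟩, hu1.prodMk_nhds hu2⟩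
      · rintro ⟨q, hq, hlim⟩
        refine ⟨fun n => (q n).1, fun n => (hq n).1, (continuous_fst.tendsto _).comp hlim, ?_⟩
        exact ((continuous_snd.tendsto _).comp hlim).congr fun n => (hq n).2.symm
    rw [this]
    exact isClosed_closure.preimage (by fun_prop)
  have hGsub : G ⊆ Metric.closedBall 0 K := by
    rintro v ⟨u, -, hu1, hu2⟩
    rw [mem_closedBall_zero_iff]
    refine le_of_tendsto hu2.norm ?_
    filter_upwards [hu1.eventually (Metric.ball_mem_nhds θ hr)] with n hn using hbound _ hn
  have hGcompact : IsCompact G := (isCompact_closedBall _ _).of_isClosed_subset hGclosed hGsub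
  change k ∈ convexHull ℝ G
  by_contra hkG
  obtain ⟨ℓ, a, hℓ, ha⟩ := geometric_hahn_banach_closed_point (convex_convexHull ℝ G)
    (isCompact_convexHull_of_isCompact hGcompact).isClosed hkG
  set d : Vec p := (InnerProductSpace.toDual ℝ (Vec p)).symm ℓ
  have hℓd : ∀ v, ℓ v = inner ℝ v d := fun v => by
    rw [real_inner_comm, InnerProductSpace.toDual_symm_apply]
  set s : ℕ → ℝ := fun n => r / (2 * (‖d‖ + 1)) / (n + 1)
  have hspos : ∀ n, 0 < s n := fun n => by positivity
  have hs0 : Tendsto s atTop (𝓝 0) := (tendsto_const_div_atTop_nhds_zero_nat (r / (2 * (‖d‖ + 1)))).comp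
    (tendsto_add_atTop_nat 1) |>.congr fun n => by simp [s]
  have hsd : ∀ n, θ + s n • d ∈ Metric.ball θ r := by
    intro n
    rw [mem_ball_iff_norm, add_sub_cancel_left, norm_smul, Real.norm_of_nonneg (hspos n).le]
    have h1 : s n ≤ r / (2 * (‖d‖ + 1)) := div_le_self (by positivity) (by simp)
    have h2 : r / (2 * (‖d‖ + 1)) * ‖d‖ < r := by
      rw [div_mul_eq_mul_div, div_lt_iff₀ (by positivity)]
      nlinarith [norm_nonneg d]
    exact (mul_le_mul_of_nonneg_right h1 (norm_nonneg d)).trans_lt h2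
  -- The displacement from `θ + s n • d` is of order `s n ^ 2`, so it still vanishes after the
  -- monotonicity inequality is divided by `s n`.
  choose u hur hud hudiff using fun n => hdense _ (hsd n) (s n * s n) (mul_pos (hspos n) (hspos n))
  have hulim : Tendsto u atTop (𝓝 θ) := by
    rw [tendsto_iff_dist_tendsto_zero]
    have : Tendsto (fun n => s n * s n + s n * ‖d‖) atTop (𝓝 0) := by
      simpa using (hs0.mul hs0).add (hs0.mul_const ‖d‖)
    refine squeeze_zero (fun _ => dist_nonneg) (fun n => ?_) this
    refine (dist_triangle _ (θ + s n • d) _).trans (add_le_add (hud n).le ?_)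
    simp [dist_eq_norm, norm_smul, abs_of_pos (hspos n)]
  obtain ⟨v, -, τ, hτ, hv⟩ := (isCompact_closedBall (0 : Vec p) (K : ℝ)).tendsto_subseq
    (x := fun n => gradient F (u n)) fun n => by simpa using hbound _ (hur n)
  have hvG : v ∈ G := ⟨u ∘ τ, fun n => hudiff _, hulim.comp hτ.tendsto_atTop, hv⟩
  have hmono : ∀ n, inner ℝ (gradient F (u n)) d ≥ inner ℝ k d - (K + ‖k‖) * s n := by
    intro n
    have h1 := inner_gradient_sub_le_of_convexOn hF (hudiff n) θ
    have h2 := hk (u n)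
    have h3 : 0 ≤ inner ℝ (gradient F (u n) - k) (u n - θ) := by
      rw [inner_sub_left]
      rw [← neg_sub, inner_neg_right] at h1
      linarith
    set e := u n - (θ + s n • d) with he
    have heq : u n - θ = s n • d + e := by rw [he]; abel
    have hes : ‖e‖ ≤ s n * s n := by
      rw [he, ← dist_eq_norm]; exact (hud n).le
    rw [heq, inner_add_right, inner_smul_right] at h3
    have h4 : inner ℝ (gradient F (u n) - k) e ≤ (K + ‖k‖) * (s n * s n) :=
      (real_inner_le_norm _ _).trans (mul_le_mul ((norm_sub_le _ _).trans
        (add_le_add_left (hbound _ (hur n)) _)) hes (norm_nonneg _) (by positivity))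
    have h5 : 0 ≤ s n * (inner ℝ (gradient F (u n) - k) d + (K + ‖k‖) * s n) := by linarith
    have h6 := nonneg_of_mul_nonneg_right h5 (hspos n)
    rw [inner_sub_left] at h6
    linarith
  have hfin : inner ℝ v d ≥ inner ℝ k d := by
    have h1 : Tendsto (fun n => inner ℝ (gradient F (u (τ n))) d) atTop (𝓝 (inner ℝ v d)) :=
      hv.inner tendsto_const_nhds
    have h2 : Tendsto (fun n => inner ℝ k d - (K + ‖k‖) * s (τ n)) atTop (𝓝 (inner ℝ k d)) := by
      simpa using tendsto_const_nhds.sub ((hs0.comp hτ.tendsto_atTop).const_mul (K + ‖k‖ : ℝ))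
    exact le_of_tendsto_of_tendsto' h2 h1 fun n => hmono _
  have := hℓ v (subset_convexHull ℝ G hvG)
  rw [hℓd] at this ha
  linarith

theorem continuous_gradient {p : ℕ} {F : Vec p → ℝ} (hF : ContDiff ℝ 1 F) :
    Continuous (gradient F) :=
  (LinearIsometryEquiv.continuous _).comp (hF.continuous_fderiv one_ne_zero)

theorem gradient_mem_clarkeSubdifferential {p : ℕ} {F : Vec p → ℝ} {θ : Vec p}
    (hF : DifferentiableAt ℝ F θ) : gradient F θ ∈ clarkeSubdifferential F θ :=
  subset_convexHull ℝ _ ⟨fun _ => θ, fun _ => hF, tendsto_const_nhds, tendsto_const_nhds⟩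

theorem eq_gradient_of_mem_clarkeSubdifferential {p : ℕ} {F : Vec p → ℝ} (hF : ContDiff ℝ 1 F)
    {θ v : Vec p} (hv : v ∈ clarkeSubdifferential F θ) : v = gradient F θ := by
  have : clarkeSubdifferential F θ ⊆ {gradient F θ} := by
    refine convexHull_min ?_ (convex_singleton _)
    rintro w ⟨u, -, hu, hw⟩
    exact tendsto_nhds_unique hw (((continuous_gradient hF).tendsto θ).comp hu)
  exact this hv

/-! ### Norms and dual norms -/

theorem continuous_seminorm {p : ℕ} (N : Seminorm ℝ (Vec p)) : Continuous N := by
  have := N.convexOn.continuousOn isOpen_univ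
  rwa [← continuousOn_univ]

theorem IsNorm.exists_equiv {p : ℕ} {N : Seminorm ℝ (Vec p)} (hN : IsNorm N) :
    ∃ C : ℝ, 0 < C ∧ ∀ u, N u ≤ C * ‖u‖ ∧ ‖u‖ ≤ C * N u := by
  have hcont : Continuous N := continuous_seminorm N
  rcases (Metric.sphere (0 : Vec p) 1).eq_empty_or_nonempty with h | h
  · have h0 : ∀ u : Vec p, u = 0 := by
      intro u
      by_contra hu
      have : (‖u‖⁻¹ • u) ∈ Metric.sphere (0 : Vec p) 1 := by
        simp [norm_smul, inv_mul_cancel₀ (norm_ne_zero_iff.2 hu)]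
      rw [h] at this
      exact this
    exact ⟨1, one_pos, fun u => by simp [h0 u]⟩
  · obtain ⟨z, hz, hzmax⟩ := (isCompact_sphere (0 : Vec p) 1).exists_isMaxOn h hcont.continuousOn
    obtain ⟨z', hz', hzmin⟩ := (isCompact_sphere (0 : Vec p) 1).exists_isMinOn h hcont.continuousOn
    have hpos : 0 < N z' := by
      refine lt_of_le_of_ne (apply_nonneg N z') fun h0 => ?_
      have := hN z' h0.symm
      simp [this] at hz'
    have hscale : ∀ u : Vec p, u ≠ 0 → N (‖u‖⁻¹ • u) = ‖u‖⁻¹ * N u ∧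
        ‖u‖⁻¹ • u ∈ Metric.sphere (0 : Vec p) 1 := by
      intro u hu
      constructor
      · rw [map_smul_eq_mul, norm_inv, norm_norm]
      · simp [norm_smul, inv_mul_cancel₀ (norm_ne_zero_iff.2 hu)]
    have hz0 : 0 ≤ N z := apply_nonneg N z
    refine ⟨N z + (N z')⁻¹, by positivity, fun u => ?_⟩
    rcases eq_or_ne u 0 with rfl | hu
    · simp
    obtain ⟨h1, h2⟩ := hscale u hu
    have hu0 : 0 < ‖u‖ := norm_pos_iff.2 hu
    have h3 : N (‖u‖⁻¹ • u) ≤ N z := hzmax h2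
    have h4 : N z' ≤ N (‖u‖⁻¹ • u) := hzmin h2
    rw [h1, inv_mul_le_iff₀ hu0] at h3
    rw [h1, le_inv_mul_iff₀ hu0] at h4
    have h5 : ‖u‖ ≤ (N z')⁻¹ * N u := by
      rw [le_inv_mul_iff₀ hpos]; linarith
    have h6 : 0 ≤ (N z')⁻¹ * ‖u‖ := by positivity
    have h7 : 0 ≤ N z * N u := mul_nonneg hz0 (apply_nonneg N u)
    constructor <;> nlinarith

section DualNorm

variable {p : ℕ} {N : Seminorm ℝ (Vec p)}

theorem dualNorm_le {v : Vec p} {B : ℝ} (hB : 0 ≤ B) (h : ∀ u, N u = 1 → inner ℝ u v ≤ B) :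
    dualNorm N v ≤ B :=
  Real.sSup_le (by rintro _ ⟨u, hu, rfl⟩; exact h u hu) hB

theorem inner_le_dualNorm (hN : IsNorm N) (u v : Vec p) :
    inner ℝ u v ≤ N u * dualNorm N v := by
  obtain ⟨C, hC, hCN⟩ := hN.exists_equiv
  have hbdd : BddAbove {r : ℝ | ∃ u : Vec p, N u = 1 ∧ r = inner ℝ u v} := by
    refine ⟨C * ‖v‖, ?_⟩
    rintro _ ⟨w, hw, rfl⟩
    refine (real_inner_le_norm _ _).trans ?_
    have := (hCN w).2
    rw [hw, mul_one] at this
    gcongr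
  rcases eq_or_ne u 0 with rfl | hu
  · simp
  have hu0 : 0 < N u := lt_of_le_of_ne (apply_nonneg N u) fun h => hu (hN u h.symm)
  have : inner ℝ ((N u)⁻¹ • u) v ≤ dualNorm N v := by
    refine le_csSup hbdd ⟨_, ?_, rfl⟩
    rw [map_smul_eq_mul, Real.norm_of_nonneg (by positivity), inv_mul_cancel₀ hu0.ne']
  rwa [real_inner_smul_left, inv_mul_le_iff₀ hu0] at this

theorem dualNorm_nonneg (hN : IsNorm N) (v : Vec p) : 0 ≤ dualNorm N v := by
  by_cases h : ∃ u, N u = 1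
  · obtain ⟨u, hu⟩ := h
    have h1 := inner_le_dualNorm hN u v
    have h2 := inner_le_dualNorm hN (-u) v
    rw [map_neg_eq_map, inner_neg_left] at h2
    rw [hu] at h1 h2
    linarith
  -- Without unit vectors (`p = 0`) the supremum is over the empty set and takes the default value
  -- `0`.
  · have : {r : ℝ | ∃ u : Vec p, N u = 1 ∧ r = inner ℝ u v} = ∅ := by
      ext r
      simp only [Set.mem_ofPred_eq, Set.mem_empty_iff_false, iff_false]
      rintro ⟨u, hu, -⟩
      exact h ⟨u, hu⟩
    rw [dualNorm, this, Real.sSup_empty]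

theorem dualNorm_add_le (hN : IsNorm N) (v w : Vec p) :
    dualNorm N (v + w) ≤ dualNorm N v + dualNorm N w := by
  refine dualNorm_le (add_nonneg (dualNorm_nonneg hN v) (dualNorm_nonneg hN w)) fun u hu => ?_
  have h1 := inner_le_dualNorm hN u v
  have h2 := inner_le_dualNorm hN u w
  rw [inner_add_right]
  rw [hu] at h1 h2
  linarith

theorem dualNorm_le_norm {C : ℝ} (hC : 0 ≤ C) (hCN : ∀ u, N u ≤ C * ‖u‖ ∧ ‖u‖ ≤ C * N u)
    (v : Vec p) : dualNorm N v ≤ C * ‖v‖ := by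
  refine dualNorm_le (by positivity) fun u hu => (real_inner_le_norm _ _).trans ?_
  have := (hCN u).2
  rw [hu, mul_one] at this
  gcongr

theorem norm_le_dualNorm (hN : IsNorm N) {C : ℝ} (hCN : ∀ u, N u ≤ C * ‖u‖ ∧ ‖u‖ ≤ C * N u)
    (v : Vec p) : ‖v‖ ≤ C * dualNorm N v := by
  rcases eq_or_ne v 0 with rfl | hv
  · have h0 : (0 : ℝ) ≤ dualNorm N 0 := dualNorm_nonneg hN _
    have h1 : dualNorm N (0 : Vec p) ≤ 0 := dualNorm_le le_rfl fun u _ => by simp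
    simp [le_antisymm h1 h0]
  have h1 := inner_le_dualNorm hN v v
  rw [real_inner_self_eq_norm_sq] at h1
  have h2 := mul_le_mul_of_nonneg_right (hCN v).1 (dualNorm_nonneg hN v)
  have h3 : 0 < ‖v‖ := norm_pos_iff.2 hv
  nlinarith

theorem inner_le_of_mem_argminOnSphere (hne : ∃ w, N w = 1) {r : ℝ} (hr : 0 ≤ r) {u v : Vec p}
    (hu : u ∈ argminOnSphere N r v) : inner ℝ u v ≤ -(r * dualNorm N v) := by
  have h : ∀ w, N w = 1 → r * inner ℝ w v ≤ -inner ℝ u v := by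
    intro w hw
    have h1 := hu.2 (-(r • w)) (by
      rw [map_neg_eq_map, map_smul_eq_mul, hw, Real.norm_of_nonneg hr, mul_one])
    rw [inner_neg_left, real_inner_smul_left] at h1
    linarith
  obtain ⟨w₀, hw₀⟩ := hne
  rcases hr.eq_or_lt with rfl | hr
  · have := h w₀ hw₀
    linarith
  · have : dualNorm N v ≤ -inner ℝ u v / r := by
      refine csSup_le ⟨_, w₀, hw₀, rfl⟩ ?_
      rintro _ ⟨w, hw, rfl⟩
      rw [le_div_iff₀ hr, mul_comm]
      exact h w hw
    rw [le_div_iff₀ hr] at this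
    linarith

/-- A functional norming `θ`, scaled by `N θ`, is a convex subgradient of `½ N²`: the defect in the
subgradient inequality is at least `½ (N w - N θ)²`. -/
theorem smul_mem_clarkeSubdifferential_half_sq {θ v : Vec p} (hv : ∀ u, inner ℝ u v ≤ N u)
    (hθ : inner ℝ θ v = N θ) :
    N θ • v ∈ clarkeSubdifferential (fun u => (1 / 2 : ℝ) * N u ^ 2) θ := by
  refine subgradient_mem_clarkeSubdifferential ?_ fun w => ?_
  · exact (N.convexOn.pow (fun u _ => apply_nonneg N u) 2).smul (by norm_num)
  · rw [real_inner_comm, inner_smul_right, inner_sub_left, hθ]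
    nlinarith [mul_le_mul_of_nonneg_left (hv w) (apply_nonneg N θ), sq_nonneg (N w - N θ)]

end DualNorm

/-! ### Loss exponents -/

/-- Since `φ'` is nondecreasing, `b = φ' 0` bounds it below on `[0, ∞)`, where `log φ'` therefore
has slope `φ'' / φ' ≤ B₂ / b`. The single constant `B = B₁ + B₂ / b` serves both Lipschitz bounds.
The last clause is the tangent inequality at `q`, evaluated at `0`. -/
theorem IsLossExponent.exists_const {φ : ℝ → ℝ} (hφ : IsLossExponent φ) :
    ∃ b B : ℝ, 0 < b ∧ 0 < B ∧ (∀ q, 0 ≤ q → b ≤ deriv φ q) ∧ (∀ q, 0 < deriv φ q) ∧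
      (∀ q, deriv φ q ≤ B) ∧ (∀ r q, 0 ≤ r → r ≤ q → b * (q - r) ≤ φ q - φ r) ∧
      (∀ r q, |φ q - φ r| ≤ B * |q - r|) ∧
      (∀ r q, 0 ≤ r → 0 ≤ q →
        |Real.log (deriv φ q) - Real.log (deriv φ r)| ≤ B * |q - r|) ∧
      ∀ q, 0 ≤ q → φ q - φ 0 ≤ deriv φ q * q := by
  obtain ⟨B₁, hB₁⟩ := hφ.deriv_bounds
  obtain ⟨B₂, hB₂⟩ := hφ.deriv2_bounds
  have hd : Differentiable ℝ φ := hφ.contDiff.differentiable (by norm_num)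
  have hd1 : ContDiff ℝ 1 (deriv φ) :=
    (contDiff_succ_iff_deriv.1 (show ContDiff ℝ (1 + 1) φ from hφ.contDiff)).2.2
  have hd' : Differentiable ℝ (deriv φ) := hd1.differentiable (by norm_num)
  have hmono : Monotone (deriv φ) := monotone_of_deriv_nonneg hd' fun u => (hB₂ u).1
  set b := deriv φ 0 with hb
  have hbpos : 0 < b := (hB₁ 0).1
  have hB₁pos : 0 < B₁ := (hB₁ 0).1.trans_le (hB₁ 0).2
  have hB₂pos : 0 ≤ B₂ := (hB₂ 0).1.trans (hB₂ 0).2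
  have hlow : ∀ q, 0 ≤ q → b ≤ deriv φ q := fun q hq => hmono hq
  refine ⟨b, B₁ + B₂ / b, hbpos, by positivity, hlow, fun q => (hB₁ q).1, fun q => ?_,
    fun r q hr hrq => ?_, fun r q => ?_, fun r q hr hq => ?_, fun q hq => ?_⟩
  · have : 0 ≤ B₂ / b := by positivity
    linarith [(hB₁ q).2]
  · refine (convex_Ici (0 : ℝ)).mul_sub_le_image_sub_of_le_deriv hd.continuous.continuousOn
      hd.differentiableOn (fun z hz => ?_) r hr q (hr.trans hrq) hrq
    rw [interior_Ici] at hz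
    exact hlow z hz.le
  · have := Convex.norm_image_sub_le_of_norm_deriv_le (f := φ) (C := B₁) (s := Set.univ)
      (x := r) (y := q) (fun z _ => hd z)
      (fun z _ => by rw [Real.norm_of_nonneg (hB₁ z).1.le]; exact (hB₁ z).2)
      convex_univ trivial trivial
    simp only [Real.norm_eq_abs] at this
    have h2 : 0 ≤ B₂ / b * |q - r| := by positivity
    linarith
  · have := Convex.norm_image_sub_le_of_norm_deriv_le (f := fun z => Real.log (deriv φ z))
      (C := B₂ / b) (s := Set.Ici 0) (x := r) (y := q)
      (fun z _ => (hd' z).log (hB₁ z).1.ne')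
      (fun z hz => by
        rw [deriv.log (hd' z) (hB₁ z).1.ne',
          Real.norm_of_nonneg (div_nonneg (hB₂ z).1 (hB₁ z).1.le)]
        exact div_le_div₀ hB₂pos (hB₂ z).2 hbpos (hlow z hz))
      (convex_Ici 0) hr hq
    simp only [Real.norm_eq_abs] at this
    have h2 : 0 ≤ B₁ * |q - r| := by positivity
    linarith
  · have := (convex_Iic q).image_sub_le_mul_sub_of_deriv_le hd.continuous.continuousOn
      hd.differentiableOn (C := deriv φ q) (fun z hz => hmono (by simpa using interior_subset hz))
      0 hq q (Set.mem_Iic.2 le_rfl) hq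
    linarith

/-! ### Homogeneous functions -/

section Homogeneous

variable {p : ℕ} {F : Vec p → ℝ} {L : ℝ}

theorem gradient_smul_of_homogeneous (hF : Differentiable ℝ F)
    (hom : ∀ (θ : Vec p) (α : ℝ), 0 < α → F (α • θ) = α ^ L * F θ) {α : ℝ} (hα : 0 < α)
    (θ : Vec p) : gradient F (α • θ) = α ^ (L - 1) • gradient F θ := by
  refine ext_inner_right ℝ fun w => ?_
  rw [real_inner_smul_left, inner_gradient_left, inner_gradient_left]
  have h1 : HasFDerivAt (fun z : Vec p => F (α • z)) (α • fderiv ℝ F (α • θ)) θ := by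
    have := (hF (α • θ)).hasFDerivAt.comp θ ((hasFDerivAt_id θ).const_smul α)
    convert! this using 1
    ext z
    simp
  have h2 : HasFDerivAt (fun z : Vec p => F (α • z)) (α ^ L • fderiv ℝ F θ) θ := by
    have := (hF θ).hasFDerivAt.const_smul (α ^ L)
    convert! this using 1
    ext z
    exact hom z α hα
  have h3 := congrArg (fun ℓ : Vec p →L[ℝ] ℝ => ℓ w) (h1.unique h2)
  simp only [_root_.smul_apply, smul_eq_mul] at h3
  rw [Real.rpow_sub_one hα.ne', div_mul_eq_mul_div, eq_div_iff hα.ne', ← h3, mul_comm]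

theorem inner_gradient_self_of_homogeneous (hF : Differentiable ℝ F)
    (hom : ∀ (θ : Vec p) (α : ℝ), 0 < α → F (α • θ) = α ^ L * F θ) (θ : Vec p) :
    inner ℝ (gradient F θ) θ = L * F θ := by
  rw [inner_gradient_left]
  have h1 : HasDerivAt (fun α : ℝ => F (α • θ)) (fderiv ℝ F θ θ) 1 := by
    refine HasFDerivAt.comp_hasDerivAt (1 : ℝ) (by simpa using (hF θ).hasFDerivAt) ?_
    simpa using (hasDerivAt_id (1 : ℝ)).smul_const θ
  have h2 : HasDerivAt (fun α : ℝ => F (α • θ)) (L * F θ) 1 := by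
    have h3 : HasDerivAt (fun α : ℝ => α ^ L * F θ) (L * F θ) 1 := by
      simpa using (Real.hasDerivAt_rpow_const (x := 1) (p := L) (Or.inl one_ne_zero)).mul_const (F θ)
    refine h3.congr_of_eventuallyEq ?_
    filter_upwards [lt_mem_nhds one_pos] with α hα using hom θ α hα
  exact h1.unique h2

theorem exists_norm_gradient_le (hF : ContDiff ℝ 1 F)
    (hom : ∀ (θ : Vec p) (α : ℝ), 0 < α → F (α • θ) = α ^ L * F θ) :
    ∃ H : ℝ, 0 ≤ H ∧ ∀ R : ℝ, 0 < R → ∀ θ : Vec p, ‖θ‖ ≤ R →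
      ‖gradient F θ‖ ≤ H * R ^ (L - 1) := by
  obtain ⟨H, hH⟩ := (isCompact_closedBall (0 : Vec p) 1).exists_bound_of_continuousOn
    (continuous_gradient hF).continuousOn
  refine ⟨H, (norm_nonneg _).trans (hH 0 (by simp)), fun R hR θ hθ => ?_⟩
  have h1 : θ = R • (R⁻¹ • θ) := by rw [smul_inv_smul₀ hR.ne']
  have h2 : R⁻¹ • θ ∈ Metric.closedBall (0 : Vec p) 1 := by
    rw [mem_closedBall_zero_iff, norm_smul, norm_inv, Real.norm_of_nonneg hR.le,
      inv_mul_le_iff₀ hR]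
    simpa using hθ
  rw [h1, gradient_smul_of_homogeneous (hF.differentiable one_ne_zero) hom hR, norm_smul,
    Real.norm_of_nonneg (by positivity), mul_comm]
  gcongr
  exact hH _ h2

theorem abs_sub_le_of_norm_gradient_le (hF : Differentiable ℝ F) {R M : ℝ}
    (hM : ∀ θ : Vec p, ‖θ‖ ≤ R → ‖gradient F θ‖ ≤ M) {u v : Vec p} (hu : ‖u‖ ≤ R)
    (hv : ‖v‖ ≤ R) : |F u - F v| ≤ M * ‖u - v‖ := by
  have := (convex_closedBall (0 : Vec p) R).norm_image_sub_le_of_norm_fderiv_le (𝕜 := ℝ) (f := F)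
    (C := M) (x := v) (y := u) (fun z _ => hF z) (fun z hz => ?_) (by simpa using hv)
    (by simpa using hu)
  · simpa using this
  · have := hM z (by simpa using hz)
    rwa [gradient, LinearIsometryEquiv.norm_map] at this

end Homogeneous

/-! ### The loss of a family of margins -/

/-- The loss `∑ᵢ exp (-φ (Fᵢ θ))` of a family of margin functions. -/
noncomputable def sumLoss {p m : ℕ} (φ : ℝ → ℝ) (F : Fin m → Vec p → ℝ) (θ : Vec p) : ℝ :=
  ∑ i, Real.exp (-φ (F i θ))

/-- The weight `e^{-φ (Fᵢ θ)} φ' (Fᵢ θ)` of the `i`-th margin in the gradient of the loss. -/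
noncomputable def lossWeight {p m : ℕ} (φ : ℝ → ℝ) (F : Fin m → Vec p → ℝ) (i : Fin m) (θ : Vec p) : ℝ :=
  Real.exp (-φ (F i θ)) * deriv φ (F i θ)

section SumLoss

variable {p m : ℕ} {φ : ℝ → ℝ} {F : Fin m → Vec p → ℝ}

theorem contDiff_sumLoss (hφ : ContDiff ℝ 2 φ) (hF : ∀ i, ContDiff ℝ 1 (F i)) :
    ContDiff ℝ 1 (sumLoss φ F) := by
  have h1 : ContDiff ℝ 1 φ := hφ.of_le (by norm_num)
  exact ContDiff.sum fun i _ => (h1.comp (hF i)).neg.exp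

theorem gradient_sumLoss (hφ : Differentiable ℝ φ) (hF : ∀ i, Differentiable ℝ (F i))
    (θ : Vec p) :
    gradient (sumLoss φ F) θ = -∑ i, lossWeight φ F i θ • gradient (F i) θ := by
  refine ext_inner_right ℝ fun w => ?_
  have h1 : HasFDerivAt (sumLoss φ F)
      (∑ i, Real.exp (-φ (F i θ)) • (-(deriv φ (F i θ) • fderiv ℝ (F i) θ))) θ := by
    have := HasFDerivAt.fun_sum (u := Finset.univ) (x := θ)
      (A := fun i (θ : Vec p) => Real.exp (-φ (F i θ)))
      (A' := fun i => Real.exp (-φ (F i θ)) • (-(deriv φ (F i θ) • fderiv ℝ (F i) θ)))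
      fun i _ => (((hφ (F i θ)).hasDerivAt.comp_hasFDerivAt θ (hF i θ).hasFDerivAt).neg).exp
    exact this
  rw [inner_gradient_left, h1.fderiv, inner_neg_left, sum_inner, _root_.sum_apply,
    ← Finset.sum_neg_distrib]
  refine Finset.sum_congr rfl fun i _ => ?_
  rw [real_inner_smul_left, inner_gradient_left, lossWeight]
  simp
  ring

end SumLoss

/-! ### Slowly varying conic combinations -/

theorem abs_log_sub_log_le {a b κ : ℝ} (hκ : 0 < κ) (ha : κ ≤ a) (hb : κ ≤ b) :
    |Real.log a - Real.log b| ≤ κ⁻¹ * |a - b| := by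
  have key : ∀ a b : ℝ, κ ≤ a → κ ≤ b → Real.log a - Real.log b ≤ κ⁻¹ * |a - b| := by
    intro a b ha hb
    have ha0 := hκ.trans_le ha
    have hb0 := hκ.trans_le hb
    rw [← Real.log_div ha0.ne' hb0.ne']
    calc Real.log (a / b) ≤ a / b - 1 := Real.log_le_sub_one_of_pos (by positivity)
      _ = b⁻¹ * (a - b) := by field_simp
      _ ≤ b⁻¹ * |a - b| := by gcongr; exact le_abs_self _
      _ ≤ κ⁻¹ * |a - b| := by gcongr
  rw [abs_le]
  have := key b a hb ha
  rw [abs_sub_comm] at this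
  exact ⟨by linarith, key a b ha hb⟩

theorem abs_sub_le_of_abs_log_sub_log_le {a b z : ℝ} (ha : 0 < a) (hb : 0 < b)
    (h : |Real.log a - Real.log b| ≤ z) : |a - b| ≤ (Real.exp z - 1) * b := by
  rw [abs_le] at h
  have h1 : a ≤ Real.exp z * b := by
    calc a = Real.exp (Real.log a) := (Real.exp_log ha).symm
      _ ≤ Real.exp (z + Real.log b) := Real.exp_le_exp.2 (by linarith)
      _ = Real.exp z * b := by rw [Real.exp_add, Real.exp_log hb]
  have h2 : Real.exp (-z) * b ≤ a := by
    calc Real.exp (-z) * b = Real.exp (-z + Real.log b) := by rw [Real.exp_add, Real.exp_log hb]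
      _ ≤ Real.exp (Real.log a) := Real.exp_le_exp.2 (by linarith)
      _ = a := Real.exp_log ha
  have h3 : 1 - Real.exp (-z) ≤ Real.exp z - 1 := by
    linarith [Real.add_one_le_exp z, Real.add_one_le_exp (-z)]
  rw [abs_le]
  constructor <;> nlinarith

/-- The coefficients vary by factors `e^(± ε (t - s))` and the vectors `h i` converge, so the change
of `g` is small relative to `∑ G i`. The absence of cancellation, `∑ G i ≤ K ‖g‖`, makes it small
relative to `‖g‖`. -/
theorem norm_sub_le_of_slowly_varying_sum {p m : ℕ} {G : Fin m → ℝ → ℝ} {h : Fin m → ℝ → Vec p}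
    {g : ℝ → Vec p} (hg : ∀ᶠ t in atTop, g t = -∑ i, G i t • h i t)
    (hpos : ∀ᶠ t in atTop, ∀ i, 0 < G i t)
    (hlog : ∀ ε : ℝ, 0 < ε → ∀ᶠ T in atTop, ∀ s t : ℝ, T ≤ s → s ≤ t → ∀ i,
      |Real.log (G i s) - Real.log (G i t)| ≤ ε * (t - s))
    {ℓ : Fin m → Vec p} (hlim : ∀ i, Tendsto (h i) atTop (𝓝 (ℓ i))) {K : ℝ} (hK0 : 0 ≤ K)
    (hK : ∀ᶠ t in atTop, ∑ i, G i t ≤ K * ‖g t‖) :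
    ∃ K' : ℝ, 0 ≤ K' ∧ ∀ ε : ℝ, 0 < ε → ∀ᶠ T in atTop, ∀ s t : ℝ, T ≤ s → s ≤ t →
      ‖g s - g t‖ ≤ K' * (Real.exp (ε * (t - s)) - 1 + ε) * ‖g t‖ := by
  set H : ℝ := ∑ i, ‖ℓ i‖ + 1
  have hH0 : 0 ≤ H := by positivity
  have hbound : ∀ᶠ t in atTop, ∀ i, ‖h i t‖ ≤ H := by
    rw [eventually_all]
    intro i
    refine (hlim i).norm.eventually (eventually_le_nhds ?_)
    have : ‖ℓ i‖ ≤ ∑ i, ‖ℓ i‖ :=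
      Finset.single_le_sum (f := fun i => ‖ℓ i‖) (fun _ _ => norm_nonneg _) (Finset.mem_univ i)
    linarith
  refine ⟨(H + 1) * K, by positivity, fun ε hε => ?_⟩
  have hclose : ∀ᶠ t in atTop, ∀ i, ‖h i t - ℓ i‖ ≤ ε / 2 := by
    rw [eventually_all]
    intro i
    have := (hlim i).eventually (Metric.closedBall_mem_nhds (ℓ i) (half_pos hε))
    filter_upwards [this] with t ht
    rwa [← dist_eq_norm]
  filter_upwards [eventually_forall_ge_atTop.2 (hg.and (hpos.and (hK.and (hbound.and hclose)))),
    hlog ε hε] with T hT hTlog s t hs hst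
  obtain ⟨hgs, hps, -, hbs, hcs⟩ := hT s hs
  obtain ⟨hgt, hpt, hKt, -, hct⟩ := hT t (hs.trans hst)
  set X := Real.exp (ε * (t - s)) - 1
  have hX : 0 ≤ X := by
    have := Real.one_le_exp (x := ε * (t - s)) (mul_nonneg hε.le (sub_nonneg.2 hst))
    simp only [X]; linarith
  have hterm : ∀ i, ‖G i s • h i s - G i t • h i t‖ ≤ (H + 1) * (X + ε) * G i t := by
    intro i
    have h1 : G i s • h i s - G i t • h i t =
        (G i s - G i t) • h i s + G i t • ((h i s - ℓ i) - (h i t - ℓ i)) := by module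
    have h2 := abs_sub_le_of_abs_log_sub_log_le (hps i) (hpt i) (hTlog s t hs hst i)
    have h3 : ‖(h i s - ℓ i) - (h i t - ℓ i)‖ ≤ ε :=
      (norm_sub_le _ _).trans (by linarith [hcs i, hct i])
    calc ‖G i s • h i s - G i t • h i t‖
        ≤ |G i s - G i t| * ‖h i s‖ + G i t * ‖(h i s - ℓ i) - (h i t - ℓ i)‖ := by
          rw [h1]
          refine (norm_add_le _ _).trans (le_of_eq ?_)
          rw [norm_smul, norm_smul, Real.norm_eq_abs, Real.norm_of_nonneg (hpt i).le]
      _ ≤ (X * G i t) * H + G i t * ε := by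
          have := (hpt i).le
          have h0 : 0 ≤ X * G i t := mul_nonneg hX this
          gcongr
          exact hbs i
      _ ≤ (H + 1) * (X + ε) * G i t := by
          have h0 := mul_nonneg hX (hpt i).le
          have h0' := mul_nonneg (mul_nonneg hH0 hε.le) (hpt i).le
          nlinarith
  calc ‖g s - g t‖ = ‖∑ i, (G i s • h i s - G i t • h i t)‖ := by
        rw [hgs, hgt, Finset.sum_sub_distrib, ← norm_neg]
        congr 1
        abel
    _ ≤ ∑ i, (H + 1) * (X + ε) * G i t := norm_sum_le_of_le _ fun i _ => hterm i
    _ = (H + 1) * (X + ε) * ∑ i, G i t := by rw [Finset.mul_sum]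
    _ ≤ (H + 1) * (X + ε) * (K * ‖g t‖) := by gcongr
    _ = (H + 1) * K * (X + ε) * ‖g t‖ := by ring

/-! ### Directionally convergent arcs -/

theorem seminorm_eq_one_of_tendsto {p : ℕ} {N : Seminorm ℝ (Vec p)} {θ : ℝ → Vec p}
    {θbar : Vec p} (hpos : ∀ᶠ t in atTop, 0 < N (θ t))
    (hdir : Tendsto (fun t => (N (θ t))⁻¹ • θ t) atTop (𝓝 θbar)) : N θbar = 1 := by
  refine tendsto_nhds_unique (((continuous_seminorm N).tendsto θbar).comp hdir) ?_
  refine tendsto_const_nhds.congr' ?_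
  filter_upwards [hpos] with t ht
  rw [Function.comp_apply, map_smul_eq_mul, Real.norm_of_nonneg (by positivity),
    inv_mul_cancel₀ ht.ne']

/-- A continuous curve `θ` that stays away from the origin and converges in direction to a point
`θbar` at which the smallest of the homogeneous margins `Fᵢ` is `γ > 0`. -/
structure ConvergesInDirection {p m : ℕ} (N : Seminorm ℝ (Vec p)) (F : Fin m → Vec p → ℝ)
    (L : ℝ) (φ : ℝ → ℝ) (θ : ℝ → Vec p) (θbar : Vec p) (γ : ℝ) : Prop where
  isNorm : IsNorm N
  one_le : 1 ≤ L
  smooth : ∀ i, ContDiff ℝ 1 (F i)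
  hom : ∀ (i : Fin m) (θ : Vec p) (α : ℝ), 0 < α → F i (α • θ) = α ^ L * F i θ
  lossExponent : IsLossExponent φ
  continuousOn : ContinuousOn θ (Set.Ici 0)
  away : ∃ ν : ℝ, 0 < ν ∧ ∀ᶠ t in atTop, ν ≤ N (θ t)
  direction : Tendsto (fun t => (N (θ t))⁻¹ • θ t) atTop (𝓝 θbar)
  margin_pos : 0 < γ
  margin_le : ∀ i, γ ≤ F i θbar
  exists_margin_eq : ∃ i, F i θbar = γ

namespace ConvergesInDirection

variable {p m : ℕ} {N : Seminorm ℝ (Vec p)} {F : Fin m → Vec p → ℝ} {L : ℝ} {φ : ℝ → ℝ}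
  {θ : ℝ → Vec p} {θbar : Vec p} {γ : ℝ}

theorem eventually_pos (h : ConvergesInDirection N F L φ θ θbar γ) :
    ∀ᶠ t in atTop, 0 < N (θ t) := by
  obtain ⟨ν, hν, hev⟩ := h.away
  filter_upwards [hev] with t ht using hν.trans_le ht

theorem norm_limit (h : ConvergesInDirection N F L φ θ θbar γ) : N θbar = 1 :=
  seminorm_eq_one_of_tendsto h.eventually_pos h.direction

theorem apply_eq (h : ConvergesInDirection N F L φ θ θbar γ) (i : Fin m) {t : ℝ}
    (ht : 0 < N (θ t)) : F i (θ t) = N (θ t) ^ L * F i ((N (θ t))⁻¹ • θ t) := by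
  rw [← h.hom i _ _ ht, smul_inv_smul₀ ht.ne']

theorem gradient_eq (h : ConvergesInDirection N F L φ θ θbar γ) (i : Fin m) {t : ℝ}
    (ht : 0 < N (θ t)) : gradient (F i) (θ t) =
      N (θ t) ^ (L - 1) • gradient (F i) ((N (θ t))⁻¹ • θ t) := by
  rw [← gradient_smul_of_homogeneous ((h.smooth i).differentiable one_ne_zero) (h.hom i) ht,
    smul_inv_smul₀ ht.ne']

theorem tendsto_apply_direction (h : ConvergesInDirection N F L φ θ θbar γ) (i : Fin m) :
    Tendsto (fun t => F i ((N (θ t))⁻¹ • θ t)) atTop (𝓝 (F i θbar)) :=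
  ((h.smooth i).continuous.tendsto θbar).comp h.direction

theorem tendsto_gradient_direction (h : ConvergesInDirection N F L φ θ θbar γ) (i : Fin m) :
    Tendsto (fun t => gradient (F i) ((N (θ t))⁻¹ • θ t)) atTop (𝓝 (gradient (F i) θbar)) :=
  ((continuous_gradient (h.smooth i)).tendsto θbar).comp h.direction

theorem eventually_le_apply (h : ConvergesInDirection N F L φ θ θbar γ) :
    ∀ᶠ t in atTop, ∀ i, γ / 2 ≤ F i ((N (θ t))⁻¹ • θ t) := by
  rw [eventually_all]
  intro i
  refine (h.tendsto_apply_direction i).eventually (eventually_ge_nhds ?_)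
  linarith [h.margin_le i, h.margin_pos]

theorem eventually_apply_le (h : ConvergesInDirection N F L φ θ θbar γ) :
    ∃ M : ℝ, 0 < M ∧ ∀ᶠ t in atTop, ∀ i, F i (θ t) ≤ M * N (θ t) ^ L := by
  have hnn : ∀ i, 0 ≤ F i θbar := fun i => h.margin_pos.le.trans (h.margin_le i)
  refine ⟨∑ i, F i θbar + 1, add_pos_of_nonneg_of_pos (Finset.sum_nonneg fun i _ => hnn i) one_pos, ?_⟩
  have : ∀ᶠ t in atTop, ∀ i, F i ((N (θ t))⁻¹ • θ t) ≤ ∑ i, F i θbar + 1 := by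
    rw [eventually_all]
    intro i
    refine (h.tendsto_apply_direction i).eventually (eventually_le_nhds ?_)
    linarith [Finset.single_le_sum (fun i _ => hnn i) (Finset.mem_univ i)]
  filter_upwards [this, h.eventually_pos] with t ht hpos i
  rw [h.apply_eq i hpos, mul_comm]
  gcongr
  exact ht i

theorem eventually_apply_pos (h : ConvergesInDirection N F L φ θ θbar γ) :
    ∀ᶠ t in atTop, ∀ i, 0 ≤ F i (θ t) := by
  filter_upwards [h.eventually_le_apply, h.eventually_pos] with t ht hpos i
  rw [h.apply_eq i hpos]
  exact mul_nonneg (by positivity) ((half_pos h.margin_pos).le.trans (ht i))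

theorem lossWeight_pos (hφ : IsLossExponent φ) (i : Fin m) (z : Vec p) :
    0 < lossWeight φ F i z := by
  obtain ⟨B₁, hB₁⟩ := hφ.deriv_bounds
  exact mul_pos (Real.exp_pos _) (hB₁ _).1

theorem differentiable_lossExponent (h : ConvergesInDirection N F L φ θ θbar γ) :
    Differentiable ℝ φ :=
  h.lossExponent.contDiff.differentiable (by norm_num)

theorem differentiable (h : ConvergesInDirection N F L φ θ θbar γ) (i : Fin m) :
    Differentiable ℝ (F i) :=
  (h.smooth i).differentiable one_ne_zero

theorem gradient_loss_eq (h : ConvergesInDirection N F L φ θ θbar γ) {t : ℝ}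
    (ht : 0 < N (θ t)) : gradient (sumLoss φ F) (θ t) = -∑ i,
      (lossWeight φ F i (θ t) * N (θ t) ^ (L - 1)) •
        gradient (F i) ((N (θ t))⁻¹ • θ t) := by
  rw [gradient_sumLoss h.differentiable_lossExponent h.differentiable]
  congr 1
  refine Finset.sum_congr rfl fun i _ => ?_
  rw [h.gradient_eq i ht, smul_smul]

theorem inner_gradient_loss (h : ConvergesInDirection N F L φ θ θbar γ) (z : Vec p) :
    inner ℝ (gradient (sumLoss φ F) z) z = -(L * ∑ i, lossWeight φ F i z * F i z) := by
  rw [gradient_sumLoss h.differentiable_lossExponent h.differentiable, inner_neg_left, sum_inner,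
    Finset.mul_sum]
  congr 1
  refine Finset.sum_congr rfl fun i _ => ?_
  rw [real_inner_smul_left, inner_gradient_self_of_homogeneous (h.differentiable i) (h.hom i)]
  ring

/-- Tests the gradient against `-θ`: Euler's identity turns the pairing into `L ∑ lossWeight * F i`,
and near `θbar` every `F i` is at least `γ / 2 * N ^ L`, so all terms have the same sign. -/
theorem eventually_sum_lossWeight_le (h : ConvergesInDirection N F L φ θ θbar γ) :
    ∀ᶠ t in atTop, ∑ i, lossWeight φ F i (θ t) * N (θ t) ^ (L - 1) ≤
      2 / (L * γ) * dualNorm N (gradient (sumLoss φ F) (θ t)) := by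
  have hL : 0 < L := one_pos.trans_le h.one_le
  filter_upwards [h.eventually_le_apply, h.eventually_pos] with t ht hpos
  have h1 := inner_le_dualNorm h.isNorm (-θ t) (gradient (sumLoss φ F) (θ t))
  rw [map_neg_eq_map, inner_neg_left, real_inner_comm, h.inner_gradient_loss, neg_neg] at h1
  have h2 : N (θ t) * (γ / 2 * ∑ i, lossWeight φ F i (θ t) * N (θ t) ^ (L - 1)) ≤
      ∑ i, lossWeight φ F i (θ t) * F i (θ t) := by
    rw [Finset.mul_sum, Finset.mul_sum]
    refine Finset.sum_le_sum fun i _ => ?_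
    rw [h.apply_eq i hpos]
    have h3 : N (θ t) ^ L = N (θ t) ^ (L - 1) * N (θ t) := by
      rw [Real.rpow_sub_one hpos.ne']; field_simp
    rw [h3]
    have h4 := (lossWeight_pos (F := F) h.lossExponent i (θ t)).le
    calc N (θ t) * (γ / 2 * (lossWeight φ F i (θ t) * N (θ t) ^ (L - 1)))
        = lossWeight φ F i (θ t) * (N (θ t) ^ (L - 1) * N (θ t) * (γ / 2)) := by ring
      _ ≤ _ := by gcongr; exact ht i
  have h5 : N (θ t) * (L * (γ / 2 * ∑ i, lossWeight φ F i (θ t) * N (θ t) ^ (L - 1))) ≤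
      N (θ t) * dualNorm N (gradient (sumLoss φ F) (θ t)) := by
    refine le_trans ?_ h1
    rw [mul_left_comm]
    gcongr
  have h6 := le_of_mul_le_mul_left h5 hpos
  have hγ := h.margin_pos
  rw [div_mul_eq_mul_div, le_div_iff₀ (by positivity)]
  linarith

theorem continuousOn_gradient_loss (h : ConvergesInDirection N F L φ θ θbar γ) :
    ContinuousOn (fun t => gradient (sumLoss φ F) (θ t)) (Set.Ici 0) :=
  (continuous_gradient (contDiff_sumLoss h.lossExponent.contDiff h.smooth)).comp_continuousOn
    h.continuousOn

/-- Bounds the speed of the unnormalized dynamics. The weights decay like `e^(-κ N^L)`, which beats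
the growth `N^(L - 1)` of the gradients of the margins; the initial time interval is handled by
continuity. -/
theorem exists_norm_gradient_loss_le (h : ConvergesInDirection N F L φ θ θbar γ) :
    ∃ G : ℝ, ∀ t, 0 ≤ t → ‖gradient (sumLoss φ F) (θ t)‖ ≤ G := by
  obtain ⟨b, B, hb, hB, -, hφpos, hφB, hφlow, -⟩ := h.lossExponent.exists_const
  have hγ := h.margin_pos
  set κ := b * (γ / 2)
  have hκ : 0 < κ := by positivity
  set H : ℝ := ∑ i, ‖gradient (F i) θbar‖ + 1
  have hgrad : ∀ᶠ t in atTop, ∀ i, ‖gradient (F i) ((N (θ t))⁻¹ • θ t)‖ ≤ H := by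
    rw [eventually_all]
    intro i
    refine (h.tendsto_gradient_direction i).norm.eventually (eventually_le_nhds ?_)
    have := Finset.single_le_sum (f := fun i => ‖gradient (F i) θbar‖)
      (fun _ _ => norm_nonneg _) (Finset.mem_univ i)
    simp only [H]; linarith
  have hev : ∀ᶠ t in atTop, ‖gradient (sumLoss φ F) (θ t)‖ ≤
      ∑ _i : Fin m, Real.exp (-φ 0) * B * (1 + κ⁻¹) * H := by
    filter_upwards [hgrad, h.eventually_le_apply, h.eventually_pos, h.eventually_apply_pos]
      with t ht hle hpos hF0
    rw [h.gradient_loss_eq hpos, norm_neg]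
    refine norm_sum_le_of_le _ fun i _ => ?_
    rw [norm_smul, Real.norm_of_nonneg
      (mul_nonneg (lossWeight_pos h.lossExponent i _).le (by positivity))]
    refine mul_le_mul ?_ (ht i) (norm_nonneg _) (by positivity)
    set X := N (θ t) ^ L
    have hX : 0 < X := by positivity
    have h1 : N (θ t) ^ (L - 1) ≤ 1 + X := by
      rcases le_total (N (θ t)) 1 with h1 | h1
      · have := Real.rpow_le_one hpos.le h1 (sub_nonneg.2 h.one_le)
        linarith
      · have : N (θ t) ^ (L - 1) ≤ X := Real.rpow_le_rpow_of_exponent_le h1 (by linarith)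
        linarith
    have h2 : φ 0 + κ * X ≤ φ (F i (θ t)) := by
      have h3 := hφlow 0 (F i (θ t)) le_rfl (hF0 i)
      rw [h.apply_eq i hpos] at h3 ⊢
      have h4 : κ * X ≤ b * (X * F i ((N (θ t))⁻¹ • θ t)) := by
        simp only [κ]
        rw [mul_assoc, mul_comm (γ / 2) X]
        gcongr
        exact hle i
      linarith
    have h3 : Real.exp (-φ (F i (θ t))) ≤ Real.exp (-φ 0) * Real.exp (-(κ * X)) := by
      rw [← Real.exp_add]
      exact Real.exp_le_exp.2 (by linarith)
    have h4 : Real.exp (-(κ * X)) * (1 + X) ≤ 1 + κ⁻¹ := by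
      have h5 : 1 + κ * X ≤ Real.exp (κ * X) := by linarith [Real.add_one_le_exp (κ * X)]
      rw [Real.exp_neg, inv_mul_le_iff₀ (Real.exp_pos _)]
      calc 1 + X ≤ (1 + κ * X) * (1 + κ⁻¹) := by
            have : κ * X * κ⁻¹ = X := by field_simp
            have h6 : 0 < κ⁻¹ := by positivity
            nlinarith [mul_pos hκ hX]
        _ ≤ _ := by gcongr
    calc lossWeight φ F i (θ t) * N (θ t) ^ (L - 1)
        ≤ (Real.exp (-φ 0) * Real.exp (-(κ * X)) * B) * (1 + X) := by
          unfold lossWeight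
          have := (hφpos (F i (θ t))).le
          gcongr
          exact hφB _
      _ = Real.exp (-φ 0) * B * (Real.exp (-(κ * X)) * (1 + X)) := by ring
      _ ≤ _ := by gcongr
  obtain ⟨T, hT⟩ := eventually_atTop.1 hev
  obtain ⟨G, hG⟩ := (isCompact_Icc (a := (0 : ℝ)) (b := T)).exists_bound_of_continuousOn
    (h.continuousOn_gradient_loss.mono Set.Icc_subset_Ici_self)
  refine ⟨max G (∑ _i : Fin m, Real.exp (-φ 0) * B * (1 + κ⁻¹) * H), fun t ht => ?_⟩
  rcases le_total t T with htT | htT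
  · exact (hG t ⟨ht, htT⟩).trans (le_max_left _ _)
  · exact (hT t htT).trans (le_max_right _ _)

end ConvergesInDirection

/-! ### Momentum steepest descent arcs: slow variation of the gradient -/

/-- A directionally convergent arc driven, with learning rate `η`, by steepest descent steps with
respect to the momentum estimate of the gradient of the loss; the step length is at
least `min 1 (N_* m)`. -/
structure IsDescentArc {p m : ℕ} (N : Seminorm ℝ (Vec p)) (F : Fin m → Vec p → ℝ)
    (L : ℝ) (φ : ℝ → ℝ) (c : ℝ) (η : ℝ → ℝ) (θ : ℝ → Vec p) (θbar : Vec p) (γ : ℝ) : Prop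
    extends ConvergesInDirection N F L φ θ θbar γ where
  c_pos : 0 < c
  η_pos : ∀ t, 0 ≤ t → 0 < η t
  η_int : ∀ T, 0 ≤ T → IntervalIntegrable η volume 0 T
  η_div : Tendsto (fun T : ℝ => ∫ t in (0 : ℝ)..T, η t) atTop atTop
  η_decay : Asymptotics.IsLittleO atTop η (fun t : ℝ => t ^ (1 / L - 1))
  norm_sub_le : ∃ C : ℝ, 0 < C ∧ ∀ s t, 0 ≤ s → s ≤ t → ‖θ t - θ s‖ ≤ C * ∫ r in s..t, η r
  step : ∀ᵐ t : ℝ, 0 < t → ∃ u : Vec p, HasDerivAt θ (η t • u) t ∧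
    inner ℝ u (momentum c (fun s => gradient (sumLoss φ F) (θ s)) t) ≤
      -(N u * dualNorm N (momentum c (fun s => gradient (sumLoss φ F) (θ s)) t)) ∧
    min 1 (dualNorm N (momentum c (fun s => gradient (sumLoss φ F) (θ s)) t)) ≤ N u

/-- Balances the growth `t^(1 - 1/L)` of the margin gradients along the curve against the increments
of `t^(1/L)` that bound its motion. -/
theorem rpow_mul_rpow_sub_rpow_le {L s t : ℝ} (hL : 1 ≤ L) (hs : 0 < s) (hst : s ≤ t) :
    t ^ (1 - 1 / L) * (t ^ (1 / L) - s ^ (1 / L)) ≤ t - s := by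
  have ht := hs.trans_le hst
  have h1 : 0 ≤ 1 - 1 / L := by
    rw [sub_nonneg, div_le_one (by linarith)]; exact hL
  have e1 : t ^ (1 - 1 / L) * t ^ (1 / L) = t := by
    rw [← Real.rpow_add ht]; simp
  have e2 : s ^ (1 - 1 / L) * s ^ (1 / L) = s := by
    rw [← Real.rpow_add hs]; simp
  have e3 : s ^ (1 - 1 / L) * s ^ (1 / L) ≤ t ^ (1 - 1 / L) * s ^ (1 / L) := by gcongr
  rw [mul_sub]
  linarith

namespace IsDescentArc

variable {p m : ℕ} {N : Seminorm ℝ (Vec p)} {F : Fin m → Vec p → ℝ} {L : ℝ} {φ : ℝ → ℝ}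
  {c : ℝ} {η : ℝ → ℝ} {θ : ℝ → Vec p} {θbar : Vec p} {γ : ℝ}

theorem intervalIntegrable (h : IsDescentArc N F L φ c η θ θbar γ) {s t : ℝ} (hs : 0 ≤ s)
    (ht : 0 ≤ t) : IntervalIntegrable η volume s t :=
  (h.η_int s hs).symm.trans (h.η_int t ht)

/-- Integrates the eventual bound on `η` by a small multiple of `t^(1/L - 1)`, whose primitive is
proportional to `t^(1/L)`. -/
theorem eventually_norm_sub_le_rpow (h : IsDescentArc N F L φ c η θ θbar γ) {ε : ℝ} (hε : 0 < ε) :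
    ∀ᶠ T in atTop, ∀ s t : ℝ, T ≤ s → s ≤ t →
      ‖θ t - θ s‖ ≤ ε * (t ^ (1 / L) - s ^ (1 / L)) := by
  obtain ⟨C, hC, hlip⟩ := h.norm_sub_le
  have hL : 0 < L := one_pos.trans_le h.one_le
  have hε' : 0 < ε / (C * L) := by positivity
  filter_upwards [eventually_forall_ge_atTop.2 (h.η_decay.def hε'), eventually_gt_atTop (0 : ℝ)]
    with T hT hT0 s t hs hst
  have hs0 : 0 < s := hT0.trans_le hs
  have hr : -1 < 1 / L - 1 := by
    have : 0 < 1 / L := by positivity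
    linarith
  have hint : ∫ r in s..t, η r ≤ ∫ r in s..t, ε / (C * L) * r ^ (1 / L - 1) := by
    refine intervalIntegral.integral_mono_on hst (h.intervalIntegrable hs0.le (hs0.le.trans hst))
      ((intervalIntegral.intervalIntegrable_rpow' hr).const_mul _) fun r hr => ?_
    have h1 := hT r (hs.trans hr.1)
    rw [Real.norm_of_nonneg (Real.rpow_nonneg (hs0.le.trans hr.1) _)] at h1
    exact (Real.le_norm_self _).trans h1
  rw [intervalIntegral.integral_const_mul, integral_rpow (Or.inl hr), sub_add_cancel] at hint
  refine (hlip s t hs0.le hst).trans ?_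
  calc C * ∫ r in s..t, η r ≤ C * (ε / (C * L) * ((t ^ (1 / L) - s ^ (1 / L)) / (1 / L))) := by
        gcongr
    _ = ε * (t ^ (1 / L) - s ^ (1 / L)) := by field_simp

theorem eventually_norm_sub_le (h : IsDescentArc N F L φ c η θ θbar γ) {ε : ℝ} (hε : 0 < ε) :
    ∀ᶠ T in atTop, ∀ s t : ℝ, T ≤ s → s ≤ t → ‖θ t - θ s‖ ≤ ε * (t - s) := by
  filter_upwards [h.eventually_norm_sub_le_rpow hε, eventually_ge_atTop (1 : ℝ)]
    with T hT hT1 s t hs hst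
  refine (hT s t hs hst).trans ?_
  have hs0 : 0 < s := by linarith
  have h1 := rpow_mul_rpow_sub_rpow_le h.one_le hs0 hst
  have hL : 0 < L := one_pos.trans_le h.one_le
  have h2 : 1 ≤ t ^ (1 - 1 / L) := by
    refine Real.one_le_rpow (by linarith) ?_
    rw [sub_nonneg, div_le_one hL]
    exact h.one_le
  have h3 : 0 ≤ t ^ (1 / L) - s ^ (1 / L) := by
    rw [sub_nonneg]
    gcongr
  exact mul_le_mul_of_nonneg_left (by nlinarith) hε.le

theorem exists_norm_le_rpow (h : IsDescentArc N F L φ c η θ θbar γ) :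
    ∃ R : ℝ, 0 < R ∧ ∀ᶠ t in atTop, ‖θ t‖ ≤ R * t ^ (1 / L) := by
  obtain ⟨T, hT, hT1⟩ := ((h.eventually_norm_sub_le_rpow one_pos).and
    (eventually_ge_atTop (1 : ℝ))).exists
  have hL : 0 < L := one_pos.trans_le h.one_le
  refine ⟨‖θ T‖ + 1, by positivity, ?_⟩
  filter_upwards [eventually_ge_atTop T] with t ht
  have h1 := hT T t le_rfl ht
  have h2 : ‖θ t‖ ≤ ‖θ t - θ T‖ + ‖θ T‖ := by simpa using norm_add_le (θ t - θ T) (θ T)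
  have h3 : 0 ≤ T ^ (1 / L) := by positivity
  have h4 : 1 ≤ t ^ (1 / L) := Real.one_le_rpow (hT1.trans ht) (by positivity)
  nlinarith [norm_nonneg (θ T)]

/-- The gradient of `F i` is `O(t^(1 - 1/L))` on a ball of radius `R t^(1/L)` containing both
points. Multiplied by the increment of `θ`, this leaves a small multiple of `t - s`; here the decay
exponent of `η` is exactly right. -/
theorem eventually_abs_apply_sub_le (h : IsDescentArc N F L φ c η θ θbar γ) {ε : ℝ}
    (hε : 0 < ε) : ∀ᶠ T in atTop, ∀ s t : ℝ, T ≤ s → s ≤ t → ∀ i,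
      |F i (θ s) - F i (θ t)| ≤ ε * (t - s) := by
  have hL : 0 < L := one_pos.trans_le h.one_le
  obtain ⟨R, hR, hθR⟩ := h.exists_norm_le_rpow
  choose H hH0 hH using fun i => exists_norm_gradient_le (h.smooth i) (h.hom i)
  have hall : ∀ i, ∀ᶠ T in atTop, ∀ s t : ℝ, T ≤ s → s ≤ t →
      |F i (θ s) - F i (θ t)| ≤ ε * (t - s) := by
    intro i
    have hε' : 0 < ε / (H i * R ^ (L - 1) + 1) := by
      have := hH0 i
      positivity
    filter_upwards [h.eventually_norm_sub_le_rpow hε', eventually_forall_ge_atTop.2 hθR,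
      eventually_gt_atTop (0 : ℝ)] with T hT hTR hT0 s t hs hst
    have hs0 : 0 < s := hT0.trans_le hs
    have ht0 : 0 < t := hs0.trans_le hst
    have hsR : ‖θ s‖ ≤ R * t ^ (1 / L) := (hTR s hs).trans (by gcongr)
    have hpow : (R * t ^ (1 / L)) ^ (L - 1) = R ^ (L - 1) * t ^ (1 - 1 / L) := by
      rw [Real.mul_rpow hR.le (by positivity), ← Real.rpow_mul ht0.le]
      congr 2
      field_simp
    have h1 := abs_sub_le_of_norm_gradient_le (h.differentiable i)
      (hH i (R * t ^ (1 / L)) (by positivity)) hsR (hTR t (hs.trans hst))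
    rw [hpow, norm_sub_rev] at h1
    have h2 := hT s t hs hst
    have h3 := rpow_mul_rpow_sub_rpow_le h.one_le hs0 hst
    have hH0i := hH0 i
    calc |F i (θ s) - F i (θ t)| ≤ H i * (R ^ (L - 1) * t ^ (1 - 1 / L)) * ‖θ t - θ s‖ := h1
      _ ≤ H i * (R ^ (L - 1) * t ^ (1 - 1 / L)) *
          (ε / (H i * R ^ (L - 1) + 1) * (t ^ (1 / L) - s ^ (1 / L))) := by gcongr
      _ = (H i * R ^ (L - 1)) * (ε / (H i * R ^ (L - 1) + 1)) *
          (t ^ (1 - 1 / L) * (t ^ (1 / L) - s ^ (1 / L))) := by ring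
      _ ≤ (H i * R ^ (L - 1)) * (ε / (H i * R ^ (L - 1) + 1)) * (t - s) := by gcongr
      _ ≤ ε * (t - s) := by
          have : (H i * R ^ (L - 1)) * (ε / (H i * R ^ (L - 1) + 1)) ≤ ε := by
            rw [mul_div_assoc', div_le_iff₀ (by positivity)]
            nlinarith
          exact mul_le_mul_of_nonneg_right this (sub_nonneg.2 hst)
  filter_upwards [eventually_all.2 hall] with T hT s t hs hst i using hT i s t hs hst

theorem eventually_abs_log_weight_sub_le (h : IsDescentArc N F L φ c η θ θbar γ) {ε : ℝ}
    (hε : 0 < ε) : ∀ᶠ T in atTop, ∀ s t : ℝ, T ≤ s → s ≤ t → ∀ i,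
      |Real.log (lossWeight φ F i (θ s) * N (θ s) ^ (L - 1)) -
        Real.log (lossWeight φ F i (θ t) * N (θ t) ^ (L - 1))| ≤ ε * (t - s) := by
  obtain ⟨b, B, hb, hB, -, hφpos, -, -, hφlip, hφlog, -⟩ := h.lossExponent.exists_const
  obtain ⟨C, hC, hCN⟩ := h.isNorm.exists_equiv
  obtain ⟨ν, hν, hev⟩ := h.away
  have hL1 : 0 ≤ L - 1 := sub_nonneg.2 h.one_le
  have hε1 : 0 < ε / (4 * B) := by positivity
  have hε2 : 0 < ε / (2 * ((L - 1) * ν⁻¹ * C + 1)) := by positivity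
  filter_upwards [h.eventually_abs_apply_sub_le hε1, h.eventually_norm_sub_le hε2,
    eventually_forall_ge_atTop.2 hev, eventually_forall_ge_atTop.2 h.eventually_apply_pos]
    with T h1 h2 h3 h4 s t hs hst i
  have hts : 0 ≤ t - s := sub_nonneg.2 hst
  have hNs := hν.trans_le (h3 s hs)
  have hNt := hν.trans_le (h3 t (hs.trans hst))
  -- The three summands will contribute `ε/4`, `ε/4` and `ε/2`.
  have hlog : ∀ r, 0 < N (θ r) → Real.log (lossWeight φ F i (θ r) * N (θ r) ^ (L - 1)) =
      -φ (F i (θ r)) + Real.log (deriv φ (F i (θ r))) + (L - 1) * Real.log (N (θ r)) := by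
    intro r hr
    rw [Real.log_mul (ConvergesInDirection.lossWeight_pos h.lossExponent i _).ne' (by positivity),
      Real.log_rpow hr, lossWeight, Real.log_mul (Real.exp_pos _).ne' (hφpos _).ne', Real.log_exp]
  rw [hlog s hNs, hlog t hNt]
  have e1 := hφlip (F i (θ t)) (F i (θ s))
  have e2 := hφlog (F i (θ t)) (F i (θ s)) (h4 t (hs.trans hst) i) (h4 s hs i)
  have e3 := abs_log_sub_log_le hν (h3 s hs) (h3 t (hs.trans hst))
  have e4 : |N (θ s) - N (θ t)| ≤ C * ‖θ t - θ s‖ := by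
    rw [norm_sub_rev]
    exact (abs_sub_map_le_sub N _ _).trans (hCN _).1
  have e5 : B * |F i (θ s) - F i (θ t)| ≤ ε / 4 * (t - s) := by
    calc B * |F i (θ s) - F i (θ t)| ≤ B * (ε / (4 * B) * (t - s)) := by
          gcongr; exact h1 s t hs hst i
      _ = ε / 4 * (t - s) := by field_simp
  have e6 : (L - 1) * |Real.log (N (θ s)) - Real.log (N (θ t))| ≤ ε / 2 * (t - s) := by
    calc (L - 1) * |Real.log (N (θ s)) - Real.log (N (θ t))|
        ≤ (L - 1) * (ν⁻¹ * (C * (ε / (2 * ((L - 1) * ν⁻¹ * C + 1)) * (t - s)))) := by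
          gcongr
          refine e3.trans ?_
          gcongr
          refine e4.trans ?_
          gcongr
          exact h2 s t hs hst
      _ = ((L - 1) * ν⁻¹ * C) / ((L - 1) * ν⁻¹ * C + 1) * (ε / 2 * (t - s)) := by
          field_simp
      _ ≤ 1 * (ε / 2 * (t - s)) := by
          gcongr
          rw [div_le_one (by positivity)]
          linarith
      _ = ε / 2 * (t - s) := one_mul _
  have e7 := abs_mul (L - 1) (Real.log (N (θ s)) - Real.log (N (θ t)))
  rw [abs_of_nonneg hL1] at e7
  rw [← e7] at e6
  have f1 := abs_le.1 (e1.trans e5)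
  have f2 := abs_le.1 (e2.trans e5)
  have f3 := abs_le.1 e6
  rw [abs_le]
  constructor <;> nlinarith [f1.1, f1.2, f2.1, f2.2, f3.1, f3.2]

theorem eventually_gradient_ne_zero (h : IsDescentArc N F L φ c η θ θbar γ) :
    ∀ᶠ t in atTop, gradient (sumLoss φ F) (θ t) ≠ 0 := by
  filter_upwards [h.eventually_sum_lossWeight_le, h.eventually_pos] with t ht hpos h0
  obtain ⟨i, -⟩ := h.exists_margin_eq
  have h1 : dualNorm N (0 : Vec p) ≤ 0 := dualNorm_le le_rfl fun u _ => by simp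
  have hterm : ∀ j, 0 < lossWeight φ F j (θ t) * N (θ t) ^ (L - 1) := fun j =>
    mul_pos (ConvergesInDirection.lossWeight_pos h.lossExponent j _) (by positivity)
  have h2 := (hterm i).trans_le (Finset.single_le_sum
    (f := fun j => lossWeight φ F j (θ t) * N (θ t) ^ (L - 1))
    (fun j _ => (hterm j).le) (Finset.mem_univ i))
  have hγ := h.margin_pos
  have hL := h.one_le
  have h3 : 2 / (L * γ) * dualNorm N (0 : Vec p) ≤ 0 :=
    mul_nonpos_of_nonneg_of_nonpos (by positivity) h1
  rw [h0] at ht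
  linarith

theorem eventually_norm_momentum_sub_le (h : IsDescentArc N F L φ c η θ θbar γ) {δ : ℝ}
    (hδ : 0 < δ) : ∀ᶠ t in atTop,
      ‖momentum c (fun s => gradient (sumLoss φ F) (θ s)) t - gradient (sumLoss φ F) (θ t)‖ ≤
        δ * ‖gradient (sumLoss φ F) (θ t)‖ := by
  obtain ⟨C, hC, hCN⟩ := h.isNorm.exists_equiv
  have hL := h.one_le
  have hγ := h.margin_pos
  obtain ⟨K, hK0, hK⟩ := norm_sub_le_of_slowly_varying_sum
    (G := fun i t => lossWeight φ F i (θ t) * N (θ t) ^ (L - 1))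
    (h := fun i t => gradient (F i) ((N (θ t))⁻¹ • θ t))
    (g := fun t => gradient (sumLoss φ F) (θ t)) (K := 2 / (L * γ) * C)
    (by filter_upwards [h.eventually_pos] with t ht using h.gradient_loss_eq ht)
    (by
      filter_upwards [h.eventually_pos] with t ht i
      exact mul_pos (ConvergesInDirection.lossWeight_pos h.lossExponent i _) (by positivity))
    (fun ε hε => h.eventually_abs_log_weight_sub_le hε)
    (fun i => h.tendsto_gradient_direction i) (by positivity)
    (by
      filter_upwards [h.eventually_sum_lossWeight_le] with t ht
      refine ht.trans ?_
      rw [mul_assoc]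
      gcongr
      exact dualNorm_le_norm hC.le hCN _)
  exact momentum_sub_le h.c_pos h.continuousOn_gradient_loss h.eventually_gradient_ne_zero hK0 hK
    δ hδ

/-- Since `m - g` is small relative to `g` in the dual norm, a step that is steepest for `m` is
nearly steepest for `g`. -/
theorem eventually_inner_gradient_le (h : IsDescentArc N F L φ c η θ θbar γ) {δ : ℝ}
    (hδ : 0 < δ) (hδ1 : δ ≤ 1) : ∀ᶠ t in atTop, ∀ u : Vec p,
      inner ℝ u (momentum c (fun s => gradient (sumLoss φ F) (θ s)) t) ≤
        -(N u * dualNorm N (momentum c (fun s => gradient (sumLoss φ F) (θ s)) t)) →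
      min 1 (dualNorm N (momentum c (fun s => gradient (sumLoss φ F) (θ s)) t)) ≤ N u →
      inner ℝ u (gradient (sumLoss φ F) (θ t)) ≤
        -((1 - δ) * (N u * dualNorm N (gradient (sumLoss φ F) (θ t)))) ∧
      (1 - δ) * min 1 (dualNorm N (gradient (sumLoss φ F) (θ t))) ≤ N u := by
  obtain ⟨C, hC, hCN⟩ := h.isNorm.exists_equiv
  -- One factor `C` is lost passing from the dual norm to the Euclidean norm, another on the way
  -- back.
  filter_upwards [h.eventually_norm_momentum_sub_le (δ := δ / (2 * (C * C))) (by positivity)]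
    with t ht u hu hu1
  set μ := momentum c (fun s => gradient (sumLoss φ F) (θ s)) t
  set g := gradient (sumLoss φ F) (θ t)
  have hg0 : 0 ≤ dualNorm N g := dualNorm_nonneg h.isNorm g
  have he : dualNorm N (g - μ) ≤ δ / 2 * dualNorm N g := by
    calc dualNorm N (g - μ) ≤ C * ‖g - μ‖ := dualNorm_le_norm hC.le hCN _
      _ ≤ C * (δ / (2 * (C * C)) * (C * dualNorm N g)) := by
          gcongr
          rw [norm_sub_rev]
          refine ht.trans ?_
          gcongr
          exact norm_le_dualNorm h.isNorm hCN g
      _ = δ / 2 * dualNorm N g := by field_simp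
  have h1 : dualNorm N g ≤ dualNorm N μ + dualNorm N (g - μ) := by
    simpa using dualNorm_add_le h.isNorm μ (g - μ)
  have h2 : (1 - δ / 2) * dualNorm N g ≤ dualNorm N μ := by linarith
  have h3 := inner_le_dualNorm h.isNorm u (g - μ)
  rw [inner_sub_right] at h3
  have hNu : 0 ≤ N u := apply_nonneg N u
  constructor
  · have h4 := mul_le_mul_of_nonneg_left he hNu
    have h5 := mul_le_mul_of_nonneg_left h2 hNu
    nlinarith
  · refine le_trans ?_ hu1
    have h6 : min 1 (dualNorm N g) ≤ 1 := min_le_left _ _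
    have h7 : min 1 (dualNorm N g) ≤ dualNorm N g := min_le_right _ _
    have h8 : 0 ≤ min 1 (dualNorm N g) := le_min zero_le_one hg0
    refine le_min ?_ ?_ <;> nlinarith

end IsDescentArc

/-! ### Descent along the arc -/

/-- `N` need not be differentiable, so the chain rule is replaced by the reverse triangle inequality
on difference quotients. -/
theorem deriv_seminorm_comp_le {p : ℕ} {N : Seminorm ℝ (Vec p)} (hN : Continuous N)
    {θ : ℝ → Vec p} {v : Vec p} {t : ℝ} (hθ : HasDerivAt θ v t)
    (hd : DifferentiableAt ℝ (fun s => N (θ s)) t) : deriv (fun s => N (θ s)) t ≤ N v := by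
  have h1 := hasDerivAt_iff_tendsto_slope.1 hd.hasDerivAt
  have h2 := (hN.tendsto v).comp (hasDerivAt_iff_tendsto_slope.1 hθ)
  refine le_of_tendsto_of_tendsto' h1 h2 fun s => ?_
  simp only [slope, vsub_eq_sub, smul_eq_mul, Function.comp_apply]
  rw [map_smul_eq_mul, Real.norm_eq_abs]
  calc (s - t)⁻¹ * (N (θ s) - N (θ t)) ≤ |(s - t)⁻¹ * (N (θ s) - N (θ t))| := le_abs_self _
    _ = |(s - t)⁻¹| * |N (θ s) - N (θ t)| := abs_mul _ _
    _ ≤ _ := by gcongr; exact abs_sub_map_le_sub N _ _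

theorem absolutelyContinuousOnInterval_log {h : ℝ → ℝ} {a b κ : ℝ}
    (hac : AbsolutelyContinuousOnInterval h a b) (hκ : 0 < κ) (hle : ∀ t ∈ Set.uIcc a b, κ ≤ h t) :
    AbsolutelyContinuousOnInterval (fun t => Real.log (h t)) a b :=
  absolutelyContinuousOnInterval_of_dist_le (C := κ⁻¹) hac fun s hs t ht => by
    simpa only [Real.dist_eq] using abs_log_sub_log_le hκ (hle s hs) (hle t ht)

namespace IsDescentArc

variable {p m : ℕ} {N : Seminorm ℝ (Vec p)} {F : Fin m → Vec p → ℝ} {L : ℝ} {φ : ℝ → ℝ}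
  {c : ℝ} {η : ℝ → ℝ} {θ : ℝ → Vec p} {θbar : Vec p} {γ : ℝ}

theorem absolutelyContinuous_integral (h : IsDescentArc N F L φ c η θ θbar γ) {S T : ℝ}
    (hS : 0 ≤ S) (hST : S ≤ T) :
    AbsolutelyContinuousOnInterval (fun t => ∫ r in (0 : ℝ)..t, η r) S T := by
  have := (h.η_int T (hS.trans hST)).absolutelyContinuousOnInterval_intervalIntegral
    (c := 0) (by simp)
  refine this.mono ?_
  rw [Set.uIcc_of_le hST, Set.uIcc_of_le (hS.trans hST)]
  exact Set.Icc_subset_Icc_left hS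

theorem absolutelyContinuous (h : IsDescentArc N F L φ c η θ θbar γ) {S T : ℝ}
    (hS : 0 ≤ S) (hST : S ≤ T) : AbsolutelyContinuousOnInterval θ S T := by
  obtain ⟨C, hC, hlip⟩ := h.norm_sub_le
  refine absolutelyContinuousOnInterval_of_dist_le (C := C)
    (h.absolutelyContinuous_integral hS hST) ?_
  have key : ∀ s t, 0 ≤ s → s ≤ t → dist (θ s) (θ t) ≤
      C * dist (∫ r in (0 : ℝ)..s, η r) (∫ r in (0 : ℝ)..t, η r) := by
    intro s t hs hst
    rw [dist_comm, dist_eq_norm, dist_comm, Real.dist_eq, intervalIntegral.integral_interval_sub_left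
      (h.η_int t (hs.trans hst)) (h.η_int s hs)]
    exact (hlip s t hs hst).trans (by gcongr; exact le_abs_self _)
  rw [Set.uIcc_of_le hST]
  intro s hs t ht
  rcases le_total s t with hst | hst
  · exact key s t (hS.trans hs.1) hst
  · rw [dist_comm, dist_comm (∫ r in (0 : ℝ)..s, η r)]
    exact key t s (hS.trans ht.1) hst

theorem absolutelyContinuous_norm (h : IsDescentArc N F L φ c η θ θbar γ) {S T : ℝ}
    (hS : 0 ≤ S) (hST : S ≤ T) : AbsolutelyContinuousOnInterval (fun t => N (θ t)) S T := by
  obtain ⟨C, hC, hCN⟩ := h.isNorm.exists_equiv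
  refine absolutelyContinuousOnInterval_of_dist_le (C := C) (h.absolutelyContinuous hS hST)
    fun s _ t _ => ?_
  rw [Real.dist_eq, dist_eq_norm]
  exact (abs_sub_map_le_sub N _ _).trans (hCN _).1

theorem absolutelyContinuous_loss (h : IsDescentArc N F L φ c η θ θbar γ) {S T : ℝ}
    (hS : 0 ≤ S) (hST : S ≤ T) :
    AbsolutelyContinuousOnInterval (fun t => sumLoss φ F (θ t)) S T := by
  have hsm := contDiff_sumLoss h.lossExponent.contDiff h.smooth
  obtain ⟨R, hR⟩ := (isCompact_Icc (a := S) (b := T)).exists_bound_of_continuousOn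
    (h.continuousOn.mono fun z hz => hS.trans hz.1)
  obtain ⟨M, hM⟩ := (isCompact_closedBall (0 : Vec p) R).exists_bound_of_continuousOn
    (continuous_gradient hsm).continuousOn
  refine absolutelyContinuousOnInterval_of_dist_le (C := M) (h.absolutelyContinuous hS hST) ?_
  rw [Set.uIcc_of_le hST]
  intro s hs t ht
  rw [Real.dist_eq, dist_eq_norm]
  exact abs_sub_le_of_norm_gradient_le (hsm.differentiable one_ne_zero)
    (fun z hz => hM z (by simpa using hz)) (hR s hs) (hR t ht)

theorem sumLoss_pos (h : IsDescentArc N F L φ c η θ θbar γ) (z : Vec p) : 0 < sumLoss φ F z := by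
  obtain ⟨i, -⟩ := h.exists_margin_eq
  exact Finset.sum_pos (fun _ _ => Real.exp_pos _) ⟨i, Finset.mem_univ i⟩

theorem hasDerivAt_loss (h : IsDescentArc N F L φ c η θ θbar γ) {t : ℝ} {u : Vec p}
    (hu : HasDerivAt θ (η t • u) t) : HasDerivAt (fun s => sumLoss φ F (θ s))
      (η t * inner ℝ u (gradient (sumLoss φ F) (θ t))) t := by
  have hd := (contDiff_sumLoss h.lossExponent.contDiff h.smooth).differentiable one_ne_zero (θ t)
  have := hd.hasFDerivAt.comp_hasDerivAt t hu
  rwa [map_smul, smul_eq_mul, ← inner_gradient_left, real_inner_comm] at this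

theorem eventually_ae_step (h : IsDescentArc N F L φ c η θ θbar γ) {δ : ℝ}
    (hδ : 0 < δ) (hδ1 : δ ≤ 1) : ∀ᶠ T in atTop, ∀ᵐ t : ℝ, T ≤ t → ∃ u : Vec p,
      HasDerivAt θ (η t • u) t ∧
      inner ℝ u (gradient (sumLoss φ F) (θ t)) ≤
        -((1 - δ) * (N u * dualNorm N (gradient (sumLoss φ F) (θ t)))) ∧
      (1 - δ) * min 1 (dualNorm N (gradient (sumLoss φ F) (θ t))) ≤ N u := by
  filter_upwards [eventually_forall_ge_atTop.2 (h.eventually_inner_gradient_le hδ hδ1),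
    eventually_gt_atTop (0 : ℝ)] with T hT hT0
  filter_upwards [h.step] with t ht hTt
  obtain ⟨u, hu, hu1, hu2⟩ := ht (hT0.trans_le hTt)
  exact ⟨u, hu, hT t hTt u hu1 hu2⟩

/-- Combines the absence of cancellation with the lower bounds `φ' ≥ b` and `N ≥ ν`. -/
theorem eventually_loss_le_dualNorm (h : IsDescentArc N F L φ c η θ θbar γ) :
    ∃ κ : ℝ, 0 < κ ∧ ∀ᶠ t in atTop,
      κ * sumLoss φ F (θ t) ≤ dualNorm N (gradient (sumLoss φ F) (θ t)) := by
  obtain ⟨b, B, hb, hB, hφb, -⟩ := h.lossExponent.exists_const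
  obtain ⟨ν, hν, hev⟩ := h.away
  have hL : 0 < L := one_pos.trans_le h.one_le
  have hL1 := h.one_le
  have hγ := h.margin_pos
  refine ⟨(2 / (L * γ))⁻¹ * (b * ν ^ (L - 1)), by positivity, ?_⟩
  filter_upwards [h.eventually_sum_lossWeight_le, h.eventually_apply_pos, hev] with t ht h0 hνt
  rw [mul_assoc, inv_mul_le_iff₀ (by positivity)]
  refine le_trans ?_ ht
  rw [sumLoss, Finset.mul_sum]
  refine Finset.sum_le_sum fun i _ => ?_
  rw [lossWeight, mul_comm, mul_assoc]
  have h1 := hφb _ (h0 i)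
  have h2 : 0 ≤ L - 1 := by linarith
  have h3 := hb.le.trans h1
  gcongr

/-- The loss eventually decreases. If it stayed above `ε`, the dual norm of the gradient and the
step length would be bounded below, so the loss would fall at rate at least `σ η`, which is
impossible since `∫ η = ∞`. -/
theorem tendsto_loss (h : IsDescentArc N F L φ c η θ θbar γ) :
    Tendsto (fun t => sumLoss φ F (θ t)) atTop (𝓝 0) := by
  obtain ⟨κ, hκ, hκev⟩ := h.eventually_loss_le_dualNorm
  obtain ⟨T, hT, hTκ, hT0⟩ := ((h.eventually_ae_step (δ := 1 / 2) (by norm_num)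
    (by norm_num)).and ((eventually_forall_ge_atTop.2 hκev).and (eventually_ge_atTop 0))).exists
  have hanti : ∀ s t, T ≤ s → s ≤ t → sumLoss φ F (θ t) ≤ sumLoss φ F (θ s) := by
    intro s t hs hst
    have hs0 := hT0.trans hs
    have := le_of_ae_deriv_nonneg hst (h.absolutelyContinuous_loss hs0 hst).neg (by
      filter_upwards [hT] with r hr hrst _
      obtain ⟨u, hu, hu1, -⟩ := hr (hs.trans hrst.1)
      rw [(h.hasDerivAt_loss hu).neg.deriv]
      have h1 := (h.η_pos r (hs0.trans hrst.1)).le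
      have h2 := mul_nonneg (apply_nonneg N u)
        (dualNorm_nonneg h.isNorm (gradient (sumLoss φ F) (θ r)))
      nlinarith)
    simpa using this
  rw [Metric.tendsto_atTop]
  intro ε hε
  suffices ∃ t, T ≤ t ∧ sumLoss φ F (θ t) < ε by
    obtain ⟨t, ht, htε⟩ := this
    refine ⟨t, fun s hs => ?_⟩
    rw [Real.dist_0_eq_abs, abs_of_pos (h.sumLoss_pos _)]
    exact (hanti t s ht hs).trans_lt htε
  by_contra! hcon
  set d := κ * ε
  have hd : 0 < d := by positivity
  -- The outer `1 / 2` is the factor `1 - δ` in the descent inequality, the inner one that in the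
  -- bound on the step length.
  set σ := 1 / 2 * (1 / 2 * min 1 d * d)
  have hσ : 0 < σ := by positivity
  have hdecr : ∀ t, T ≤ t → sumLoss φ F (θ t) + σ * ∫ r in (0 : ℝ)..t, η r ≤
      sumLoss φ F (θ T) + σ * ∫ r in (0 : ℝ)..T, η r := by
    intro t hTt
    have := le_of_ae_deriv_nonneg hTt
      (((h.absolutelyContinuous_loss hT0 hTt).add
        ((h.absolutelyContinuous_integral hT0 hTt).const_mul σ)).neg) (by
      filter_upwards [hT, (h.η_int t (hT0.trans hTt)).ae_hasDerivAt_integral] with r hr hr2 hrst _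
      obtain ⟨u, hu, hu1, hu2⟩ := hr hrst.1
      have hr0 := hT0.trans hrst.1
      have hA := hr2 (by rw [Set.uIcc_of_le (hT0.trans hTt)]; exact ⟨hr0, hrst.2⟩) 0 (by simp)
      rw [((h.hasDerivAt_loss hu).add (hA.const_mul σ)).neg.deriv]
      have h1 := (h.η_pos r hr0).le
      have h2 : d ≤ dualNorm N (gradient (sumLoss φ F) (θ r)) := by
        refine le_trans ?_ (hTκ r hrst.1)
        exact mul_le_mul_of_nonneg_left (hcon r hrst.1) hκ.le
      have h3 : 1 / 2 * min 1 d ≤ N u := by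
        refine le_trans ?_ hu2
        have : min 1 d ≤ min 1 (dualNorm N (gradient (sumLoss φ F) (θ r))) :=
          min_le_min le_rfl h2
        linarith
      have h4 : 1 / 2 * min 1 d * d ≤ N u * dualNorm N (gradient (sumLoss φ F) (θ r)) :=
        mul_le_mul h3 h2 hd.le (apply_nonneg N u)
      have h5 : inner ℝ u (gradient (sumLoss φ F) (θ r)) + σ ≤ 0 := by
        simp only [σ]; linarith
      nlinarith)
    simp only [Pi.neg_apply, Pi.add_apply] at this
    linarith
  obtain ⟨t, ht, htT⟩ := ((h.η_div.eventually_gt_atTop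
    ((sumLoss φ F (θ T) + σ * ∫ r in (0 : ℝ)..T, η r) / σ)).and (eventually_ge_atTop T)).exists
  rw [div_lt_iff₀ hσ] at ht
  have h1 := hdecr t htT
  have h2 := h.sumLoss_pos (θ t)
  linarith

/-- A single term bounds the loss below, and `φ` is Lipschitz. This caps the growth of `Z` at order
`N^L`. -/
theorem exists_neg_log_loss_le (h : IsDescentArc N F L φ c η θ θbar γ) :
    ∃ M : ℝ, 0 < M ∧ ∀ᶠ t in atTop, -Real.log (sumLoss φ F (θ t)) - φ 0 ≤ M * N (θ t) ^ L := by
  obtain ⟨b, B, hb, hB, -, -, -, -, hφlip, -⟩ := h.lossExponent.exists_const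
  obtain ⟨M, hM, hev⟩ := h.eventually_apply_le
  obtain ⟨i, -⟩ := h.exists_margin_eq
  refine ⟨B * M, by positivity, ?_⟩
  filter_upwards [hev, h.eventually_apply_pos] with t ht h0
  have h1 : Real.exp (-φ (F i (θ t))) ≤ sumLoss φ F (θ t) :=
    Finset.single_le_sum (f := fun i => Real.exp (-φ (F i (θ t))))
      (fun _ _ => (Real.exp_pos _).le) (Finset.mem_univ i)
  have h2 := Real.log_le_log (Real.exp_pos _) h1
  rw [Real.log_exp] at h2
  have h3 := (abs_le.1 (hφlip 0 (F i (θ t)))).2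
  rw [sub_zero, abs_of_nonneg (h0 i)] at h3
  have h4 := mul_le_mul_of_nonneg_left (ht i) hB.le
  linarith

theorem tendsto_neg_log_loss (h : IsDescentArc N F L φ c η θ θbar γ) :
    Tendsto (fun t => -Real.log (sumLoss φ F (θ t)) - φ 0) atTop atTop := by
  have h1 : Tendsto (fun t => Real.log (sumLoss φ F (θ t))) atTop atBot :=
    Real.tendsto_log_nhdsGT_zero.comp (tendsto_nhdsWithin_iff.2
      ⟨h.tendsto_loss, Eventually.of_forall fun t => h.sumLoss_pos _⟩)
  exact tendsto_atTop_add_const_right _ _ (tendsto_neg_atBot_atTop.comp h1)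

theorem tendsto_norm_rpow (h : IsDescentArc N F L φ c η θ θbar γ) :
    Tendsto (fun t => N (θ t) ^ L) atTop atTop := by
  obtain ⟨M, hM, hMev⟩ := h.exists_neg_log_loss_le
  exact (tendsto_const_mul_atTop_of_pos hM).1 (tendsto_atTop_mono' _ hMev h.tendsto_neg_log_loss)

/-- Each term `e^(-φ (F i))` is at most the loss, so `-log ℓ - φ 0 ≤ φ (F i) - φ 0 ≤ φ' (F i) * F i`
by convexity; these are summed with weights `e^(-φ (F i))`. -/
theorem sumLoss_mul_le (h : IsDescentArc N F L φ c η θ θbar γ) {z : Vec p}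
    (hz : ∀ i, 0 ≤ F i z) : sumLoss φ F z * (-Real.log (sumLoss φ F z) - φ 0) ≤
      ∑ i, lossWeight φ F i z * F i z := by
  obtain ⟨b, B, hb, hB, -, -, -, -, -, -, hφconv⟩ := h.lossExponent.exists_const
  nth_rewrite 1 [sumLoss]
  rw [Finset.sum_mul]
  refine Finset.sum_le_sum fun i _ => ?_
  rw [lossWeight, mul_assoc]
  refine mul_le_mul_of_nonneg_left ?_ (Real.exp_pos _).le
  refine le_trans ?_ (hφconv _ (hz i))
  have h1 : Real.exp (-φ (F i z)) ≤ sumLoss φ F z :=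
    Finset.single_le_sum (f := fun i => Real.exp (-φ (F i z)))
      (fun _ _ => (Real.exp_pos _).le) (Finset.mem_univ i)
  have h2 := Real.log_le_log (Real.exp_pos _) h1
  rw [Real.log_exp] at h2
  linarith

/-- Were alignment to fail from some time on, `log Z - K log N` would be nondecreasing for an
exponent `K > L`. Against `Z ≤ M N^L` this keeps `N`, and then `Z`, bounded, although `Z → ∞`. -/
theorem frequently_inner_gt (h : IsDescentArc N F L φ c η θ θbar γ) {ε : ℝ} (hε : 0 < ε)
    (hε1 : ε < 1) : ∃ᶠ t in atTop,
      (1 - ε) * (N (θ t) * dualNorm N (gradient (sumLoss φ F) (θ t))) <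
        -inner ℝ (gradient (sumLoss φ F) (θ t)) (θ t) := by
  by_contra hcon
  rw [not_frequently] at hcon
  obtain ⟨M, hM, hMev⟩ := h.exists_neg_log_loss_le
  obtain ⟨ν, hν, hνev⟩ := h.away
  have hL : 0 < L := one_pos.trans_le h.one_le
  set Z : ℝ → ℝ := fun t => -Real.log (sumLoss φ F (θ t)) - φ 0 with hZ
  have hZlim : Tendsto Z atTop atTop := h.tendsto_neg_log_loss
  obtain ⟨T, hT, hTcon, hTM, hTν, hTZ, hTpos, hT0⟩ := ((h.eventually_ae_step (δ := ε / 2)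
    (by positivity) (by linarith)).and ((eventually_forall_ge_atTop.2 hcon).and
    ((eventually_forall_ge_atTop.2 hMev).and ((eventually_forall_ge_atTop.2 hνev).and
    ((eventually_forall_ge_atTop.2 (hZlim.eventually_ge_atTop 1)).and
    ((eventually_forall_ge_atTop.2 h.eventually_apply_pos).and
    (eventually_ge_atTop 0))))))).exists
  -- Descent with loss factor `1 - ε/2` still beats the failed alignment, because `(1 + ε/2) (1 - ε)
  -- ≤ 1 - ε/2`.
  set K := (1 + ε / 2) * L
  have hK : 0 < K := by positivity
  have hmono : ∀ t, T ≤ t → Real.log (Z T) - K * Real.log (N (θ T)) ≤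
      Real.log (Z t) - K * Real.log (N (θ t)) := by
    intro t hTt
    have hacN := h.absolutelyContinuous_norm hT0 hTt
    have hacℓ := h.absolutelyContinuous_loss hT0 hTt
    obtain ⟨ℓ₀, hℓ₀, hℓ₀le⟩ : ∃ ℓ₀ : ℝ, 0 < ℓ₀ ∧ ∀ s ∈ Set.uIcc T t, ℓ₀ ≤ sumLoss φ F (θ s) := by
      obtain ⟨s, -, hs⟩ := isCompact_uIcc.exists_isMinOn Set.nonempty_uIcc hacℓ.continuousOn
      exact ⟨_, h.sumLoss_pos (θ s), fun r hr => hs hr⟩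
    have hacZ : AbsolutelyContinuousOnInterval Z T t :=
      absolutelyContinuousOnInterval_of_dist_le (C := 1)
        (absolutelyContinuousOnInterval_log hacℓ hℓ₀ hℓ₀le) fun s _ r _ => by
          simp only [hZ, Real.dist_eq, one_mul]
          rw [← abs_neg]
          apply le_of_eq
          congr 1
          ring
    have hlogZ := absolutelyContinuousOnInterval_log hacZ one_pos fun s hs => by
      rw [Set.uIcc_of_le hTt] at hs
      exact hTZ s hs.1
    have hlogN := absolutelyContinuousOnInterval_log hacN hν fun s hs => by
      rw [Set.uIcc_of_le hTt] at hs
      exact hTν s hs.1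
    refine le_of_ae_deriv_nonneg (h := fun t => Real.log (Z t) - K * Real.log (N (θ t))) hTt
      (hlogZ.sub (hlogN.const_mul K)) ?_
    filter_upwards [hT, hacN.ae_differentiableAt] with r hr hrN hrTt _
    rw [Set.uIcc_of_le hTt] at hrN
    obtain ⟨u, hu, hu1, -⟩ := hr hrTt.1
    have hr0 := hT0.trans hrTt.1
    have hη := (h.η_pos r hr0).le
    have hℓpos := h.sumLoss_pos (θ r)
    have hZpos : 0 < Z r := one_pos.trans_le (hTZ r hrTt.1)
    have hNpos : 0 < N (θ r) := hν.trans_le (hTν r hrTt.1)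
    have hNder := deriv_seminorm_comp_le (continuous_seminorm N) hu (hrN hrTt)
    rw [map_smul_eq_mul, Real.norm_of_nonneg hη] at hNder
    have hZder : HasDerivAt Z (-((η r * inner ℝ u (gradient (sumLoss φ F) (θ r))) /
        sumLoss φ F (θ r))) r := ((h.hasDerivAt_loss hu).log hℓpos.ne').neg.sub_const (φ 0)
    rw [((hZder.log hZpos.ne').fun_sub
      (((hrN hrTt).hasDerivAt.log hNpos.ne').const_mul K)).deriv]
    have h1 := not_lt.1 (hTcon r hrTt.1)
    rw [h.inner_gradient_loss, neg_neg] at h1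
    have h2 := h.sumLoss_mul_le (hTpos r hrTt.1)
    set D := dualNorm N (gradient (sumLoss φ F) (θ r))
    set ℓ := sumLoss φ F (θ r)
    have hD0 : 0 ≤ D := dualNorm_nonneg h.isNorm _
    have hNu := apply_nonneg N u
    have h3 : L * (ℓ * Z r) ≤ (1 - ε) * (N (θ r) * D) :=
      (mul_le_mul_of_nonneg_left h2 hL.le).trans h1
    have h4 : K * (ℓ * Z r) ≤ (1 - ε / 2) * (N (θ r) * D) := by
      have h5 : 0 ≤ N (θ r) * D := by positivity
      calc K * (ℓ * Z r) = (1 + ε / 2) * (L * (ℓ * Z r)) := by simp only [K]; ring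
        _ ≤ (1 + ε / 2) * ((1 - ε) * (N (θ r) * D)) := by gcongr
        _ ≤ (1 - ε / 2) * (N (θ r) * D) := by
            rw [← mul_assoc]
            gcongr
            nlinarith
    have h5 : K * (η r * N u / N (θ r)) ≤
        -(η r * inner ℝ u (gradient (sumLoss φ F) (θ r)) / ℓ) / Z r := by
      rw [← neg_div, div_div, le_div_iff₀ (by positivity)]
      calc K * (η r * N u / N (θ r)) * (ℓ * Z r)
          = (η r * N u / N (θ r)) * (K * (ℓ * Z r)) := by ring
        _ ≤ (η r * N u / N (θ r)) * ((1 - ε / 2) * (N (θ r) * D)) := by gcongr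
        _ = η r * ((1 - ε / 2) * (N u * D)) := by field_simp
        _ ≤ _ := by nlinarith
    have h6 : K * (deriv (fun s => N (θ s)) r / N (θ r)) ≤ K * (η r * N u / N (θ r)) := by
      gcongr
    linarith
  set P := Real.log (Z T) - K * Real.log (N (θ T))
  -- The threshold is the bound on `log (Z t)` that results from `(ε/2) L log N ≤ log M - P`.
  obtain ⟨t, ht, htT⟩ := (((Real.tendsto_log_atTop.comp hZlim).eventually_gt_atTop
    (Real.log M + (Real.log M - P) / (ε / 2))).and (eventually_ge_atTop T)).exists
  have hNpos : 0 < N (θ t) := hν.trans_le (hTν t htT)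
  have h1 := hmono t htT
  have h2 : Real.log (Z t) ≤ Real.log M + L * Real.log (N (θ t)) := by
    rw [← Real.log_rpow hNpos, ← Real.log_mul hM.ne' (by positivity)]
    exact Real.log_le_log (one_pos.trans_le (hTZ t htT)) (hTM t htT)
  simp only [Function.comp_apply] at ht
  have h3 : L * Real.log (N (θ t)) ≤ (Real.log M - P) / (ε / 2) := by
    rw [le_div_iff₀ (by positivity)]
    simp only [K] at h1
    linarith
  linarith

end IsDescentArc

/-! ### Limits of the normalized gradients -/

namespace IsDescentArc

variable {p m : ℕ} {N : Seminorm ℝ (Vec p)} {F : Fin m → Vec p → ℝ} {L : ℝ} {φ : ℝ → ℝ}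
  {c : ℝ} {η : ℝ → ℝ} {θ : ℝ → Vec p} {θbar : Vec p} {γ : ℝ}

/-- The ratio is at most `B / b * e^(-b (F i - F j))`, and the gap `F i - F j` grows like `N^L`. -/
theorem tendsto_lossWeight_div (h : IsDescentArc N F L φ c η θ θbar γ) {i j : Fin m}
    (hij : F j θbar < F i θbar) :
    Tendsto (fun t => lossWeight φ F i (θ t) / lossWeight φ F j (θ t)) atTop (𝓝 0) := by
  obtain ⟨b, B, hb, hB, hφb, hφpos, hφB, hφlow, -⟩ := h.lossExponent.exists_const
  have hd := (h.tendsto_apply_direction i).sub (h.tendsto_apply_direction j)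
  have hlim : Tendsto (fun t => B / b * Real.exp (-(b * (N (θ t) ^ L *
      (F i ((N (θ t))⁻¹ • θ t) - F j ((N (θ t))⁻¹ • θ t)))))) atTop (𝓝 0) := by
    have h1 := Real.tendsto_exp_neg_atTop_nhds_zero.comp
      ((h.tendsto_norm_rpow.atTop_mul_pos (sub_pos.2 hij) hd).const_mul_atTop hb)
    simpa using h1.const_mul (B / b)
  refine squeeze_zero' (Eventually.of_forall fun t => div_nonneg
    (ConvergesInDirection.lossWeight_pos h.lossExponent i _).le
    (ConvergesInDirection.lossWeight_pos h.lossExponent j _).le) ?_ hlim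
  filter_upwards [h.eventually_pos, h.eventually_apply_pos,
    hd.eventually (lt_mem_nhds (sub_pos.2 hij))] with t hpos h0 hlt
  rw [mul_sub, ← h.apply_eq i hpos, ← h.apply_eq j hpos]
  have hle : F j (θ t) ≤ F i (θ t) := by
    rw [h.apply_eq i hpos, h.apply_eq j hpos]
    have := (sub_pos.1 hlt).le
    gcongr
  have h1 := hφlow _ _ (h0 j) hle
  have h2 : Real.exp (-φ (F i (θ t))) ≤
      Real.exp (-(b * (F i (θ t) - F j (θ t)))) * Real.exp (-φ (F j (θ t))) := by
    rw [← Real.exp_add]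
    exact Real.exp_le_exp.2 (by linarith)
  rw [div_le_iff₀ (ConvergesInDirection.lossWeight_pos h.lossExponent j _), lossWeight, lossWeight]
  calc Real.exp (-φ (F i (θ t))) * deriv φ (F i (θ t))
      ≤ (Real.exp (-(b * (F i (θ t) - F j (θ t)))) * Real.exp (-φ (F j (θ t)))) * B :=
        mul_le_mul h2 (hφB _) (hφpos _).le (by positivity)
    _ = B / b * Real.exp (-(b * (F i (θ t) - F j (θ t)))) * (Real.exp (-φ (F j (θ t))) * b) := by
        field_simp
    _ ≤ _ := by
        gcongr
        exact hφb _ (h0 j)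

/-- The multipliers are limits of the normalized weights `w i / D`, which lie in `[0, K]`, along
times of almost perfect alignment. -/
theorem exists_multipliers (h : IsDescentArc N F L φ c η θ θbar γ) :
    ∃ lam : Fin m → ℝ, (∀ i, 0 ≤ lam i) ∧ (∀ i, lam i ≠ 0 → F i θbar = γ) ∧
      (∀ u, inner ℝ u (∑ i, lam i • gradient (F i) θbar) ≤ N u) ∧
      inner ℝ θbar (∑ i, lam i • gradient (F i) θbar) = 1 := by
  have hL1 := h.one_le
  have hγ := h.margin_pos
  set g : ℝ → Vec p := fun t => gradient (sumLoss φ F) (θ t)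
  set D : ℝ → ℝ := fun t => dualNorm N (g t)
  set w : Fin m → ℝ → ℝ := fun i t => lossWeight φ F i (θ t) * N (θ t) ^ (L - 1)
  set K : ℝ := 2 / (L * γ)
  have hgood : ∀ᶠ t in atTop, 0 < N (θ t) ∧ 0 < D t ∧ ∑ i, w i t ≤ K * D t := by
    obtain ⟨C, hC, hCN⟩ := h.isNorm.exists_equiv
    filter_upwards [h.eventually_pos, h.eventually_gradient_ne_zero,
      h.eventually_sum_lossWeight_le] with t h1 h2 h3
    refine ⟨h1, ?_, h3⟩
    have := (norm_pos_iff.2 h2).trans_le (norm_le_dualNorm h.isNorm hCN (g t))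
    exact pos_of_mul_pos_right this hC.le
  have hseq : ∀ n : ℕ, ∃ t : ℝ, (n : ℝ) ≤ t ∧ (0 < N (θ t) ∧ 0 < D t ∧ ∑ i, w i t ≤ K * D t) ∧
      (1 - 1 / ((n : ℝ) + 2)) * (N (θ t) * D t) < -inner ℝ (g t) (θ t) := by
    intro n
    have h1 : (1 : ℝ) / ((n : ℝ) + 2) < 1 := by
      rw [div_lt_one (by positivity)]
      have : (0 : ℝ) ≤ n := by positivity
      linarith
    obtain ⟨t, ht, ht1, ht2⟩ := ((h.frequently_inner_gt (ε := 1 / ((n : ℝ) + 2)) (by positivity)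
      h1).and_eventually ((eventually_ge_atTop (n : ℝ)).and hgood)).exists
    exact ⟨t, ht1, ht2, ht⟩
  choose τ hτn hτ hτin using hseq
  have hτlim : Tendsto τ atTop atTop := tendsto_atTop_mono hτn tendsto_natCast_atTop_atTop
  set μ : ℕ → Fin m → ℝ := fun n i => w i (τ n) / D (τ n) with hμ
  have hwpos : ∀ n i, 0 < w i (τ n) := fun n i =>
    have := (hτ n).1
    mul_pos (ConvergesInDirection.lossWeight_pos h.lossExponent i _) (by positivity)
  have hμmem : ∀ n, μ n ∈ Set.Icc (0 : Fin m → ℝ) (fun _ => K) := by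
    intro n
    refine ⟨fun i => div_nonneg (hwpos n i).le (hτ n).2.1.le, fun i => ?_⟩
    simp only [hμ]
    rw [div_le_iff₀ (hτ n).2.1]
    exact (Finset.single_le_sum (f := fun j => w j (τ n)) (fun j _ => (hwpos n j).le)
      (Finset.mem_univ i)).trans (hτ n).2.2
  obtain ⟨lam, hlam, σ, hσ, hσlim⟩ := isCompact_Icc.tendsto_subseq hμmem
  have hlami : ∀ i, Tendsto (fun n => μ (σ n) i) atTop (𝓝 (lam i)) := tendsto_pi_nhds.1 hσlim
  have hτσ : Tendsto (fun n => τ (σ n)) atTop atTop := hτlim.comp hσ.tendsto_atTop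
  set v : ℕ → Vec p := fun n =>
    ∑ i, μ n i • gradient (F i) ((N (θ (τ n)))⁻¹ • θ (τ n)) with hv
  have hvlim : Tendsto (fun n => v (σ n)) atTop (𝓝 (∑ i, lam i • gradient (F i) θbar)) :=
    tendsto_finsetSum _ fun i _ => (hlami i).smul ((h.tendsto_gradient_direction i).comp hτσ)
  have hvg : ∀ n, D (τ n) • v n = -g (τ n) := by
    intro n
    simp only [hv, g]
    rw [h.gradient_loss_eq (hτ n).1, neg_neg, Finset.smul_sum]
    refine Finset.sum_congr rfl fun i _ => ?_
    simp only [hμ]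
    rw [smul_smul, mul_div_cancel₀ _ (hτ n).2.1.ne']
  have hvle : ∀ n u, inner ℝ u (v n) ≤ N u := by
    intro n u
    have h1 := inner_le_dualNorm h.isNorm (-u) (g (τ n))
    rw [map_neg_eq_map, inner_neg_left, ← inner_neg_right, ← hvg, inner_smul_right, mul_comm] at h1
    exact le_of_mul_le_mul_right h1 (hτ n).2.1
  have hle : ∀ u, inner ℝ u (∑ i, lam i • gradient (F i) θbar) ≤ N u := fun u =>
    le_of_tendsto' (tendsto_const_nhds.inner hvlim) fun n => hvle _ u
  refine ⟨lam, fun i => hlam.1 i, fun i hi => ?_, hle, le_antisymm ?_ ?_⟩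
  · by_contra hne
    obtain ⟨j, hj⟩ := h.exists_margin_eq
    have hlt : F j θbar < F i θbar := by
      rw [hj]
      exact lt_of_le_of_ne (h.margin_le i) (Ne.symm hne)
    -- Compares with a margin `j` that attains `γ`: `μ i` is `μ j`, which is bounded, times a
    -- vanishing ratio.
    have h1 : Tendsto (fun n => μ (σ n) j * (lossWeight φ F i (θ (τ (σ n))) /
        lossWeight φ F j (θ (τ (σ n))))) atTop (𝓝 (lam j * 0)) :=
      (hlami j).mul ((h.tendsto_lossWeight_div hlt).comp hτσ)
    rw [mul_zero] at h1
    refine hi (tendsto_nhds_unique (hlami i) (h1.congr fun n => ?_))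
    have h2 := (ConvergesInDirection.lossWeight_pos (F := F) h.lossExponent j (θ (τ (σ n)))).ne'
    simp only [hμ, w]
    field_simp
  · exact (hle θbar).trans_eq h.norm_limit
  · have h1 : Tendsto (fun n => inner ℝ ((N (θ (τ (σ n))))⁻¹ • θ (τ (σ n))) (v (σ n))) atTop
        (𝓝 (inner ℝ θbar (∑ i, lam i • gradient (F i) θbar))) :=
      (h.direction.comp hτσ).inner hvlim
    have h2 : Tendsto (fun n : ℕ => 1 - 1 / ((n : ℝ) + 2)) atTop (𝓝 1) := by
      have h3 : Tendsto (fun n : ℕ => (1 : ℝ) / ((n : ℝ) + 2)) atTop (𝓝 0) :=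
        tendsto_const_nhds.div_atTop
          (tendsto_atTop_add_const_right _ _ tendsto_natCast_atTop_atTop)
      simpa using tendsto_const_nhds.sub h3
    refine le_of_tendsto_of_tendsto' (h2.comp hσ.tendsto_atTop) h1 fun n => ?_
    set k := σ n
    have h3 := hτin k
    rw [← inner_neg_left, ← hvg, real_inner_smul_left, real_inner_comm] at h3
    simp only [Function.comp_apply]
    rw [real_inner_smul_left, le_inv_mul_iff₀ (hτ k).1]
    refine le_of_mul_le_mul_left ?_ (hτ k).2.1
    linarith

end IsDescentArc

/-! ### From trajectories to descent arcs -/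

theorem IsArc.continuousOn {p : ℕ} {θ : ℝ → Vec p} (hθ : IsArc θ) :
    ContinuousOn θ (Set.Ici 0) := by
  obtain ⟨v, hv, hθv⟩ := hθ
  intro t ht
  have ht0 : (0 : ℝ) ≤ t := ht
  have h1 : ContinuousOn (fun x => θ 0 + ∫ s in (0 : ℝ)..x, v s) (Set.Icc 0 (t + 1)) := by
    have := intervalIntegral.continuousOn_primitive_interval
      (μ := volume) (f := v) (a := 0) (b := t + 1) (by
        rw [Set.uIcc_of_le (by linarith)]
        exact (intervalIntegrable_iff_integrableOn_Icc_of_le (by linarith)).1 (hv _ (by linarith)))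
    rw [Set.uIcc_of_le (by linarith)] at this
    exact continuousOn_const.add this
  have h2 : ContinuousOn θ (Set.Icc 0 (t + 1)) := h1.congr fun x hx => hθv x hx.1
  refine (h2 t ⟨ht0, by linarith⟩).mono_of_mem_nhdsWithin ?_
  rw [← Set.Ici_inter_Iic]
  exact inter_mem self_mem_nhdsWithin (nhdsWithin_le_nhds (Iic_mem_nhds (by linarith)))

/-- The density of the arc agrees almost everywhere with the derivative `η t • u`, so a bound on the
steps integrates. -/
theorem IsArc.norm_sub_le {p : ℕ} {θ : ℝ → Vec p} (hθ : IsArc θ) {η : ℝ → ℝ} {C : ℝ}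
    (hη_pos : ∀ t, 0 ≤ t → 0 < η t) (hη_int : ∀ T, 0 ≤ T → IntervalIntegrable η volume 0 T)
    (hd : ∀ᵐ t : ℝ, 0 < t → ∃ u : Vec p, ‖u‖ ≤ C ∧ HasDerivAt θ (η t • u) t) {s t : ℝ}
    (hs : 0 ≤ s) (hst : s ≤ t) : ‖θ t - θ s‖ ≤ C * ∫ r in s..t, η r := by
  obtain ⟨v, hv, hθv⟩ := hθ
  have ht := hs.trans hst
  have h1 : θ t - θ s = ∫ r in s..t, v r := by
    rw [hθv t ht, hθv s hs, add_sub_add_left_eq_sub,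
      intervalIntegral.integral_interval_sub_left (hv t ht) (hv s hs)]
  rw [h1, ← intervalIntegral.integral_const_mul]
  refine intervalIntegral.norm_integral_le_of_norm_le hst ?_
    (((hη_int s hs).symm.trans (hη_int t ht)).const_mul C)
  filter_upwards [hd, (hv t ht).ae_hasDerivAt_integral] with r hr hr2 hrst
  have hr0 : 0 < r := hs.trans_lt hrst.1
  obtain ⟨u, hu, hder⟩ := hr hr0
  have h2 := hr2 (by rw [Set.uIcc_of_le ht]; exact ⟨hr0.le, hrst.2⟩) 0 (by simp)
  have h3 : HasDerivAt θ (v r) r := by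
    refine (h2.const_add (θ 0)).congr_of_eventuallyEq ?_
    filter_upwards [lt_mem_nhds hr0] with x hx using hθv x hx.le
  rw [h3.unique hder, norm_smul, Real.norm_of_nonneg (hη_pos r hr0.le).le, mul_comm]
  exact mul_le_mul_of_nonneg_right hu (hη_pos r hr0.le).le

theorem momentum_congr {p : ℕ} {c : ℝ} {g g' : ℝ → Vec p} (h : ∀ t, 0 ≤ t → g t = g' t) {t : ℝ}
    (ht : 0 ≤ t) : momentum c g t = momentum c g' t := by
  refine intervalIntegral.integral_congr fun s hs => ?_
  rw [Set.uIcc_of_le ht] at hs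
  simp only [h s hs.1]

/-- Brings both dynamics to one form. The step length is `1` or the dual norm of the momentum, so it
is at least the smaller of the two, and bounded because the gradient is. -/
theorem ConvergesInDirection.isDescentArc {p m : ℕ} {N : Seminorm ℝ (Vec p)}
    {F : Fin m → Vec p → ℝ} {L : ℝ} {φ : ℝ → ℝ} {c : ℝ} {η : ℝ → ℝ} {θ : ℝ → Vec p}
    {θbar : Vec p} {γ : ℝ} (h : ConvergesInDirection N F L φ θ θbar γ) (hc : 0 < c)
    (hη_pos : ∀ t, 0 ≤ t → 0 < η t) (hη_int : ∀ T, 0 ≤ T → IntervalIntegrable η volume 0 T)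
    (hη_div : Tendsto (fun T : ℝ => ∫ t in (0 : ℝ)..T, η t) atTop atTop)
    (hη_decay : Asymptotics.IsLittleO atTop η (fun t : ℝ => t ^ (1 / L - 1)))
    (hθ : IsNormalizedMSD N (sumLoss φ F) c η θ ∨ IsUnnormalizedMSD N (sumLoss φ F) c η θ) :
    IsDescentArc N F L φ c η θ θbar γ := by
  obtain ⟨C, hC, hCN⟩ := h.isNorm.exists_equiv
  have hsm := contDiff_sumLoss h.lossExponent.contDiff h.smooth
  have hne : ∃ w, N w = 1 := ⟨θbar, h.norm_limit⟩
  obtain ⟨G, hG⟩ := h.exists_norm_gradient_loss_le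
  have hG0 : 0 ≤ G := (norm_nonneg _).trans (hG 0 le_rfl)
  set μ := momentum c (fun s => gradient (sumLoss φ F) (θ s)) with hμ
  have hμG : ∀ t, 0 ≤ t → dualNorm N (μ t) ≤ C * G := fun t ht =>
    (dualNorm_le_norm hC.le hCN _).trans
      (mul_le_mul_of_nonneg_left (norm_momentum_le hc hG ht) hC.le)
  have harc : IsArc θ := hθ.elim And.left And.left
  have hstep : ∀ᵐ t : ℝ, 0 < t → ∃ u : Vec p, HasDerivAt θ (η t • u) t ∧
      inner ℝ u (μ t) ≤ -(N u * dualNorm N (μ t)) ∧ min 1 (dualNorm N (μ t)) ≤ N u ∧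
      ‖u‖ ≤ C * (1 + C * G) := by
    rcases hθ with ⟨-, g, hg, hae⟩ | ⟨-, g, hg, hae⟩
    · filter_upwards [hae] with t ht ht0
      obtain ⟨u, hu, hder⟩ := ht ht0
      rw [momentum_congr (fun s hs => eq_gradient_of_mem_clarkeSubdifferential hsm (hg s hs))
        ht0.le, ← hμ] at hu
      have hu1 := hu.1
      have h1 := inner_le_of_mem_argminOnSphere hne zero_le_one hu
      refine ⟨u, hder, by rwa [hu1], by rw [hu1]; exact min_le_left _ _,
        (hCN u).2.trans ?_⟩
      rw [hu1]
      have : 0 ≤ C * G := by positivity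
      gcongr
      linarith
    · filter_upwards [hae] with t ht ht0
      obtain ⟨u, hu, hder⟩ := ht ht0
      rw [momentum_congr (fun s hs => eq_gradient_of_mem_clarkeSubdifferential hsm (hg s hs))
        ht0.le, ← hμ] at hu
      have hu1 := hu.1
      have h1 := inner_le_of_mem_argminOnSphere hne (dualNorm_nonneg h.isNorm _) hu
      refine ⟨u, hder, by rwa [hu1], by rw [hu1]; exact min_le_right _ _,
        (hCN u).2.trans ?_⟩
      rw [hu1]
      gcongr
      linarith [hμG t ht0.le]
  refine { h with
    c_pos := hc, η_pos := hη_pos, η_int := hη_int, η_div := hη_div, η_decay := hη_decay,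
    norm_sub_le := ⟨C * (1 + C * G), by positivity, fun s t hs hst => ?_⟩, step := ?_ }
  · refine harc.norm_sub_le hη_pos hη_int ?_ hs hst
    filter_upwards [hstep] with t ht ht0
    obtain ⟨u, hder, -, -, hu⟩ := ht ht0
    exact ⟨u, hu, hder⟩
  · filter_upwards [hstep] with t ht ht0
    obtain ⟨u, hder, h1, h2, -⟩ := ht ht0
    exact ⟨u, hder, h1, h2⟩

/-! ### KKT points -/

/-- The scale `s = γ^(-1/L)` makes the smallest margin `1`. The gradients scale by `s^(L - 1)` and
the subgradient of `½ N²` by `s`, hence the factor `s^(2 - L)` in the multipliers. -/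
theorem isKKTPoint_of_multipliers {d p m : ℕ} {N : Seminorm ℝ (Vec p)}
    {f : Vec d → Vec p → ℝ} {x : Fin m → Vec d} {y : Fin m → ℝ} {L γ : ℝ} {θbar : Vec p}
    (hL : 0 < L) (hf : ∀ z, Differentiable ℝ (f z))
    (hom : ∀ (z : Vec d) (θ : Vec p) (α : ℝ), 0 < α → f z (α • θ) = α ^ L * f z θ)
    (hγ : 0 < γ) (hmargin : ∀ i, γ ≤ y i * f (x i) θbar) (hθ : N θbar = 1) {lam : Fin m → ℝ}
    (hlam : ∀ i, 0 ≤ lam i) (hslack : ∀ i, lam i ≠ 0 → y i * f (x i) θbar = γ)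
    (hle : ∀ u, inner ℝ u (∑ i, (lam i * y i) • gradient (f (x i)) θbar) ≤ N u)
    (heq : inner ℝ θbar (∑ i, (lam i * y i) • gradient (f (x i)) θbar) = 1) :
    IsKKTPoint N f x y (γ ^ (-(1 / L)) • θbar) := by
  set s := γ ^ (-(1 / L)) with hs
  have hspos : 0 < s := by positivity
  have hsL : s ^ L = γ⁻¹ := by
    rw [hs, ← Real.rpow_mul hγ.le, ← Real.rpow_neg_one]
    congr 1
    field_simp
  have hval : ∀ i, y i * f (x i) (s • θbar) = γ⁻¹ * (y i * f (x i) θbar) := fun i => by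
    rw [hom _ _ _ hspos, hsL]; ring
  have hNs : N (s • θbar) = s := by
    rw [map_smul_eq_mul, hθ, mul_one, Real.norm_of_nonneg hspos.le]
  set v := ∑ i, (lam i * y i) • gradient (f (x i)) θbar
  refine ⟨fun i => ?_, s • v, fun i => lam i * s ^ (2 - L),
    fun i => gradient (f (x i)) (s • θbar), ?_, fun i => ?_, fun i => ?_, ?_, ?_⟩
  · rw [hval, le_inv_mul_iff₀ hγ, mul_one]
    exact hmargin i
  · have := smul_mem_clarkeSubdifferential_half_sq (N := N) (θ := s • θbar) (v := v) hle
      (by rw [real_inner_smul_left, heq, mul_one, hNs])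
    rwa [hNs] at this
  · have := hlam i
    positivity
  · exact gradient_mem_clarkeSubdifferential (hf (x i) _)
  · rw [sub_eq_zero, Finset.smul_sum]
    refine Finset.sum_congr rfl fun i _ => ?_
    beta_reduce
    rw [gradient_smul_of_homogeneous (hf (x i)) (hom (x i)) hspos, smul_smul, smul_smul]
    congr 1
    have : s ^ (2 - L) * s ^ (L - 1) = s := by
      rw [← Real.rpow_add hspos]
      norm_num
    calc lam i * s ^ (2 - L) * y i * s ^ (L - 1)
        = lam i * y i * (s ^ (2 - L) * s ^ (L - 1)) := by ring
      _ = s * (lam i * y i) := by rw [this]; ring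
  · refine Finset.sum_eq_zero fun i _ => ?_
    rcases eq_or_ne (lam i) 0 with h0 | h0
    · simp [h0]
    · rw [hval, hslack i h0, inv_mul_cancel₀ hγ.ne', sub_self, mul_zero]

end MomentumSD

/-! ### The main theorem, with the labels absorbed into the margins -/

theorem mainTheorem2 {d p m : ℕ}
    -- the dataset
    (x : Fin m → MomentumSD.Vec d) (y : Fin m → ℝ) (hy : ∀ i, y i = 1 ∨ y i = -1)
    -- the model: continuously differentiable and `L`-homogeneous in the parameters
    (f : MomentumSD.Vec d → MomentumSD.Vec p → ℝ) (L : ℝ) (hL : 1 ≤ L)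
    (hf_smooth : ∀ z, ContDiff ℝ 1 (f z))
    (hf_hom : ∀ (z : MomentumSD.Vec d) (θ : MomentumSD.Vec p) (α : ℝ), 0 < α →
      f z (α • θ) = α ^ L * f z θ)
    -- the loss
    (φ : ℝ → ℝ) (hφ : MomentumSD.IsLossExponent φ)
    -- the norm
    (N : Seminorm ℝ (MomentumSD.Vec p)) (hN : MomentumSD.IsNorm N)
    -- the momentum parameter and the learning rate schedule
    (c : ℝ) (hc : 0 < c)
    (η : ℝ → ℝ) (hη_pos : ∀ t, 0 ≤ t → 0 < η t)
    (hη_int : ∀ T, 0 ≤ T → IntervalIntegrable η MeasureTheory.volume 0 T)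
    (hη_div : Filter.Tendsto (fun T : ℝ => ∫ t in (0 : ℝ)..T, η t) Filter.atTop Filter.atTop)
    (hη_decay : Asymptotics.IsLittleO Filter.atTop η (fun t : ℝ => t ^ (1 / L - 1)))
    -- the trajectory
    (θ : ℝ → MomentumSD.Vec p)
    (hθ : MomentumSD.IsNormalizedMSD N (MomentumSD.loss φ f x y) c η θ ∨
      MomentumSD.IsUnnormalizedMSD N (MomentumSD.loss φ f x y) c η θ)
    -- it stays away from the origin
    (hθ_away : ∃ Nmin : ℝ, 0 < Nmin ∧ ∃ t₀ : ℝ, 0 ≤ t₀ ∧ ∀ t, t₀ ≤ t → Nmin ≤ N (θ t))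
    -- it converges in direction, with a positive limit margin
    (θbar : MomentumSD.Vec p)
    (hθ_dir : Filter.Tendsto (fun t => (N (θ t))⁻¹ • θ t) Filter.atTop (nhds θbar))
    (hθ_margin : 0 < MomentumSD.margin N f x y θbar) :
    ∃ s : ℝ, 0 < s ∧ MomentumSD.IsKKTPoint N f x y (s • θbar) := by 
  obtain ⟨Nmin, hNmin, t₀, -, haway⟩ := hθ_away
  have hpos : ∀ᶠ t in Filter.atTop, 0 < N (θ t) := by
    filter_upwards [Filter.eventually_ge_atTop t₀] with t ht using hNmin.trans_le (haway t ht)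
  have hθbar : N θbar = 1 := MomentumSD.seminorm_eq_one_of_tendsto hpos hθ_dir
  set γ := MomentumSD.margin N f x y θbar with hγ
  have hmargin : γ = ⨅ i, y i * f (x i) θbar := by
    rw [hγ, MomentumSD.margin, hθbar, inv_one, one_smul]
  -- An infimum over the empty type is `0`, which the positive margin excludes.
  have hne : Nonempty (Fin m) := by
    by_contra hempty
    rw [not_nonempty_iff] at hempty
    rw [hmargin, Real.iInf_of_isEmpty] at hθ_margin
    exact hθ_margin.false
  have hconv : MomentumSD.ConvergesInDirection N (fun i θ => y i * f (x i) θ) L φ θ θbar γ :=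
    { isNorm := hN
      one_le := hL
      smooth := fun i => contDiff_const.mul (hf_smooth (x i))
      hom := fun i ζ α hα => by rw [hf_hom _ _ _ hα]; ring
      lossExponent := hφ
      continuousOn := (hθ.elim And.left And.left : MomentumSD.IsArc θ).continuousOn
      away := ⟨Nmin, hNmin, (Filter.eventually_ge_atTop t₀).mono fun t ht => haway t ht⟩
      direction := hθ_dir
      margin_pos := hθ_margin
      margin_le := fun i => hmargin ▸ ciInf_le (Set.finite_range _).bddBelow i
      exists_margin_eq := hmargin ▸ exists_eq_ciInf_of_finite }
  obtain ⟨lam, hlam, hslack, hle, heq⟩ :=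
    (hconv.isDescentArc hc hη_pos hη_int hη_div hη_decay hθ).exists_multipliers
  have hdiff : ∀ z, Differentiable ℝ (f z) := fun z => (hf_smooth z).differentiable one_ne_zero
  have hgrad : ∑ i, lam i • gradient (fun ζ => y i * f (x i) ζ) θbar =
      ∑ i, (lam i * y i) • gradient (f (x i)) θbar := by
    refine Finset.sum_congr rfl fun i _ => ?_
    rw [mul_smul]
    congr 1
    refine ext_inner_right ℝ fun w => ?_
    rw [real_inner_smul_left, inner_gradient_left, inner_gradient_left,
      fderiv_const_mul (hdiff (x i) θbar)]
    rfl
  rw [hgrad] at heq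
  simp only [hgrad] at hle
  exact ⟨γ ^ (-(1 / L)), Real.rpow_pos_of_pos hθ_margin _,
    MomentumSD.isKKTPoint_of_multipliers (one_pos.trans_le hL) hdiff hf_hom hθ_margin
      hconv.margin_le hθbar hlam hslack hle heq⟩
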